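/- Fix constants $\lambda>0$ (intensity), $P>0$ (transmit power), $\eta>2$ (path-loss exponent) and $r_0>0$ (exclusion radius), and a constellation $s_1,\dots,s_M\in\mathbb{C}$ of unit power, $\frac1M\sum_{m=1}^M|s_m|^2=1$; for a uniformly chosen symbol $s$ write $\mathbb{E}\{|s|^n\}=\frac1M\sum_{m=1}^M|s_m|^n$. Let $x_1,x_2,\dots$ be the points, enumerated by increasing distance from the origin, of a Poisson point process in $\mathbb{R}^2$ with intensity measure $\lambda\,\mathbf 1_{\{\|x\|>r_0\}}\,dx$. Let $\sigma_1,\sigma_2,\dots$ be random symbols, each uniformly distributed on the constellation (with index $m$ uniform on $\{1,\dots,M\}$), and let $h_1,h_2,\dots$ be $\mathcal{CN}(0,1)$ variables (circularly symmetric complex Gaussian with mean $0$ and $\mathbb{E}|h_k|^2=1$), all $\sigma_k$ and $h_k$ being mutually independent and independent of the point process. Then the series $$ i_{agg}=\sum_{k\ge1}\sqrt P\,\sigma_k h_k\|x_k\|^{-\eta/2}, $$ summed in the order of increasing distance, converges almost surely, and its sum, the aggregate baseband interference, has the following properties. (1) $i_{agg}$ is circularly symmetric: $u\,i_{agg}$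 has the same law as $i_{agg}$ for every $u\in\mathbb{C}$ with $|u|=1$. (2) For every $\omega\in\mathbb{C}$ the characteristic function $\varphi(\omega)=\mathbb{E}\,e^{\jmath\,\mathrm{Re}(\bar\omega\, i_{agg})}$ is $$\varphi(\omega)=\exp\Big\{\frac{\pi\lambda}{M}\sum_{m=1}^M r_0^2\Big[1-{}_1F_1\Big(-\tfrac2\eta;\,1-\tfrac2\eta;\,-\frac{|\omega|^2P|s_m|^2}{4r_0^\eta}\Big)\Big]\Big\} =\exp\Big\{2\pi\lambda r_0^2\sum_{k=1}^\infty\frac{(-1)^k|\omega|^{2k}\,\mathbb{E}\{|s|^{2k}\}}{(\eta k-2)\,k!}\Big(\frac{P}{4r_0^\eta}\Big)^k\Big\},$$ where the last series converges and ${}_1F_1(a;b;z)=\sum_{n\ge0}\frac{a(a+1)\cdots(a+n-1)}{b(b+1)\cdots(b+n-1)}\frac{z^n}{n!}$ is Kummer's function. (3) For $X=\mathrm{Re}\,i_{agg}$ and for $X=\mathrm{Im}\,i_{agg}$ the function $t\mapsto\ln\mathbb{E}e^{\jmath tX}$ is smooth near $0$, and the cumulants $\kappa_n(X)=\jmath^{-n}\frac{d^n}{dt^n}\ln\mathbb{E}e^{\jmath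 tX}\big|_{t=0}$, $n\ge1$, are $$\kappa_n(X)=0\ \ (n\text{ odd}),\qquad \kappa_n(X)=\frac{\pi\lambda P^{n/2}}{2^{n-1}\left(\frac{\eta n}{2}-2\right)}\cdot\frac{n!}{(n/2)!}\;r_0^{\,2-\frac{\eta n}{2}}\;\mathbb{E}\{|s|^n\}\ \ (n\text{ even}).$$ (4) The expected power is finite and $\displaystyle\mathbb{E}\{|i_{agg}|^2\}=\frac{2\pi\lambda P\,r_0^{2-\eta}}{\eta-2}$. -/

import Mathlib

open MeasureTheory ProbabilityTheory Filter Topology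
open scoped Nat

/-- The Euclidean plane in which the transmitters are located; the receiver is at the origin. -/
abbrev Plane : Type := EuclideanSpace ℝ (Fin 2)

/-- The number (possibly `∞`) of points of the random sequence `x` that lie in `B`. -/
noncomputable def pointCount {Ω : Type*} (x : ℕ → Ω → Plane) (B : Set Plane) (ω : Ω) : ℕ∞ :=
  Set.encard {k : ℕ | x k ω ∈ B}

/-- The random points `x 0, x 1, …` are an enumeration of a Poisson point process in the plane
with intensity measure `Λ`: the number of points in a bounded Borel set `B` is Poisson with mean
`Λ B`, and the numbers of points in finitely many disjoint Borel sets are independent. -/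
structure IsPoissonPointProcess {Ω : Type*} [MeasurableSpace Ω] (μ : Measure Ω)
    (Λ : Measure Plane) (x : ℕ → Ω → Plane) : Prop where
  measurable : ∀ k, Measurable (x k)
  hasLaw_count : ∀ B : Set Plane, MeasurableSet B → Bornology.IsBounded B →
    HasLaw (pointCount x B) ((poissonMeasure (Λ B).toNNReal).map (Nat.cast : ℕ → ℕ∞)) μ
  indep_count : ∀ (m : ℕ) (B : Fin m → Set Plane), (∀ i, MeasurableSet (B i)) →
    Pairwise (Function.onFun Disjoint B) → iIndepFun (fun i => pointCount x (B i)) μ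

/-- The intensity measure `lam dx` on the exterior `‖x‖ > r₀` of the exclusion disc. -/
noncomputable def exteriorIntensity (lam r₀ : ℝ) : Measure Plane :=
  ENNReal.ofReal lam • (volume : Measure Plane).restrict {y : Plane | r₀ < ‖y‖}

/-- The law of an equiprobable symbol of the constellation `c 0, …, c (M - 1)`. -/
noncomputable def symbolLaw {M : ℕ} (c : Fin M → ℂ) : Measure ℂ :=
  (uniformOn (Set.univ : Set (Fin M))).map c

/-- The moment `𝔼 |s| ^ n` of an equiprobable symbol `s` of the constellation `c`. -/
noncomputable def symbolMoment {M : ℕ} (c : Fin M → ℂ) (n : ℕ) : ℝ :=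
  ∫ z, ‖z‖ ^ n ∂(symbolLaw c)

/-- The circularly symmetric complex Gaussian law `𝒞𝒩(0, 1)`: real and imaginary parts are
independent centred Gaussian variables of variance `1 / 2`. -/
noncomputable def stdComplexGaussian : Measure ℂ :=
  ((gaussianReal 0 (1 / 2)).prod (gaussianReal 0 (1 / 2))).map
    (fun p : ℝ × ℝ => (p.1 : ℂ) + (p.2 : ℂ) * Complex.I)

/-- The interference of the first `N` interferers,
`∑_{k < N} √P * s_k * h_k * ‖x_k‖ ^ (-η / 2)`. -/
noncomputable def partialInterference {Ω : Type*} (P η : ℝ) (x : ℕ → Ω → Plane)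
    (s h : ℕ → Ω → ℂ) (N : ℕ) (ω : Ω) : ℂ :=
  ∑ k ∈ Finset.range N, ((√P : ℝ) : ℂ) * s k ω * h k ω * ((‖x k ω‖ ^ (-(η / 2)) : ℝ) : ℂ)

/-- The aggregate interference `∑_k √P * s_k * h_k * ‖x_k‖ ^ (-η / 2)`, summed in the order of
the enumeration (for `η ≤ 4` the series need not converge absolutely). -/
noncomputable def aggregateInterference {Ω : Type*} (P η : ℝ) (x : ℕ → Ω → Plane)
    (s h : ℕ → Ω → ℂ) (ω : Ω) : ℂ :=
  limUnder atTop (fun N => partialInterference P η x s h N ω)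

/-- Kummer's confluent hypergeometric function `₁F₁(a; b; z) = ∑ (a)_n / (b)_n * z ^ n / n!`,
with rising factorials `(a)_n = a (a + 1) ⋯ (a + n - 1)`. -/
noncomputable def kummer (a b z : ℝ) : ℝ :=
  ∑' n : ℕ, (ascPochhammer ℝ n).eval a / (ascPochhammer ℝ n).eval b * (z ^ n / (n ! : ℝ))

/-- The logarithm `t ↦ ln 𝔼 exp(i t X)` of the characteristic function of a real random variable
(principal branch, hence the continuous logarithm vanishing at `0` for `t` near `0`). -/
noncomputable def logCharFun {Ω : Type*} [MeasurableSpace Ω] (μ : Measure Ω) (X : Ω → ℝ)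
    (t : ℝ) : ℂ :=
  Complex.log (charFun (μ.map X) t)

/-- The `n`-th cumulant `i⁻ⁿ (d/dt)ⁿ ln 𝔼 exp(i t X)` at `t = 0` of a real random variable. -/
noncomputable def cumulant {Ω : Type*} [MeasurableSpace Ω] (μ : Measure Ω) (X : Ω → ℝ)
    (n : ℕ) : ℂ :=
  iteratedDeriv n (logCharFun μ X) 0 / Complex.I ^ n

/-!
The products `σ_k h_k` are centred marks attached independently to the points of a Poisson process,
and the interference is the shot noise `∑ g (x_k) • W_k` with `g y = √P ‖y‖ ^ (-η / 2)`. For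
`η ≤ 4` it does not converge absolutely, but `g ^ 2` is integrable over the exterior of the
exclusion disc, so by Campbell's formula `∑ g (x_k) ^ 2 < ∞` almost surely. Conditionally on the
points the shot noise is thus a series of independent centred variables with summable variances,
which converges by Kolmogorov's theorem, and its terms are orthogonal in `L²`.

Conditioning on the points, the characteristic function becomes the generating functional
`𝔼 ∏ φ (g (x_k) • w) = exp (-∫ (1 - φ (g y • w)) dΛ y)` of the Poisson process, where `φ` is the
characteristic function of a mark. The generating functional formula follows from the Poisson counts
for step functions and extends by density: a product of factors in the unit disc is `1`-Lipschitz
for the `ℓ¹` norm, hence by Campbell's formula the functional is `1`-Lipschitz for the norm of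
`L¹(Λ)`. For Rayleigh fading the exponent is a radial integral; expanded termwise it is the Kummer
series. It depends on `‖w‖` only, and its coefficients are the cumulants.
-/

section RandomSeries

variable {Ω : Type*} [MeasurableSpace Ω] {μ : Measure Ω}

theorem eLpNorm_one_le_of_variance_le [IsProbabilityMeasure μ] {X : Ω → ℝ} (hX : MemLp X 2 μ)
    (hmean : ∫ ω, X ω ∂μ = 0) {v : ℝ} (hv : Var[X; μ] ≤ v) :
    eLpNorm X 1 μ ≤ (√v).toNNReal := by
  refine (eLpNorm_le_eLpNorm_of_exponent_le one_le_two hX.aestronglyMeasurable).trans ?_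
  rw [hX.eLpNorm_eq_integral_rpow_norm two_ne_zero ENNReal.ofNat_ne_top]
  rw [variance_of_integral_eq_zero hX.aestronglyMeasurable.aemeasurable hmean] at hv
  refine ENNReal.ofReal_le_ofReal ?_
  simpa only [ENNReal.toReal_ofNat, Real.rpow_ofNat, Real.norm_eq_abs, sq_abs, ← one_div,
    ← Real.sqrt_eq_rpow] using Real.sqrt_le_sqrt hv

theorem martingale_natural_sum_of_iIndepFun {Y : ℕ → Ω → ℝ} (hm : ∀ k, StronglyMeasurable (Y k))
    (hint : ∀ k, Integrable (Y k) μ) (hind : iIndepFun Y μ) (h0 : ∀ k, ∫ ω, Y k ω ∂μ = 0) :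
    Martingale (fun n => ∑ k ∈ Finset.range (n + 1), Y k) (Filtration.natural Y hm) μ := by
  have := hind.isProbabilityMeasure
  refine martingale_of_condExp_sub_eq_zero_nat (fun n => ?_)
    (fun n => integrable_finsetSum' _ fun k _ => hint k) fun n => ?_
  · refine Finset.stronglyMeasurable_sum _ fun k hk => ?_
    exact (Filtration.stronglyAdapted_natural hm k).mono
      ((Filtration.natural Y hm).mono (Nat.lt_succ_iff.1 (Finset.mem_range.1 hk)))
  · simp only [Finset.sum_range_succ _ (n + 1), add_sub_cancel_left]
    refine (hind.condExp_natural_ae_eq_of_lt hm n.lt_succ_self).trans ?_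
    simp only [h0]
    rfl

theorem ae_exists_tendsto_sum_of_stronglyMeasurable {Y : ℕ → Ω → ℝ}
    (hm : ∀ k, StronglyMeasurable (Y k)) (hY : ∀ k, MemLp (Y k) 2 μ) (hind : iIndepFun Y μ)
    (h0 : ∀ k, ∫ ω, Y k ω ∂μ = 0) (hs : Summable fun k => Var[Y k; μ]) :
    ∀ᵐ ω ∂μ, ∃ l : ℝ, Tendsto (fun N => ∑ k ∈ Finset.range N, Y k ω) atTop (𝓝 l) := by
  have := hind.isProbabilityMeasure
  have hint : ∀ k, Integrable (Y k) μ := fun k => (hY k).integrable one_le_two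
  have hbdd : ∀ n, eLpNorm (∑ k ∈ Finset.range (n + 1), Y k) 1 μ ≤
      (√(∑' k, Var[Y k; μ])).toNNReal := fun n => by
    refine eLpNorm_one_le_of_variance_le (memLp_finsetSum' _ fun k _ => hY k) ?_ ?_
    · simp only [Finset.sum_apply]
      rw [integral_finsetSum _ fun k _ => hint k]
      exact Finset.sum_eq_zero fun k _ => h0 k
    · rw [IndepFun.variance_sum (fun k _ => hY k) fun i _ j _ hij => hind.indepFun hij]
      exact hs.sum_le_tsum _ fun k _ => variance_nonneg _ _
  filter_upwards [(martingale_natural_sum_of_iIndepFun hm hint hind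
    h0).submartingale.exists_ae_tendsto_of_bdd hbdd] with ω ⟨l, hl⟩
  simp only [Finset.sum_apply] at hl
  exact ⟨l, (tendsto_add_atTop_iff_nat 1).1 hl⟩

/-- Kolmogorov's one-series theorem. -/
theorem ae_exists_tendsto_sum_of_summable_variance {Y : ℕ → Ω → ℝ}
    (hY : ∀ k, MemLp (Y k) 2 μ) (hind : iIndepFun Y μ)
    (h0 : ∀ k, ∫ ω, Y k ω ∂μ = 0) (hs : Summable fun k => Var[Y k; μ]) :
    ∀ᵐ ω ∂μ, ∃ l : ℝ, Tendsto (fun N => ∑ k ∈ Finset.range N, Y k ω) atTop (𝓝 l) := by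
  have he : ∀ k, Y k =ᵐ[μ] (hY k).1.mk (Y k) := fun k => (hY k).1.ae_eq_mk
  have hmk := ae_exists_tendsto_sum_of_stronglyMeasurable
    (fun k => (hY k).1.stronglyMeasurable_mk) (fun k => (hY k).ae_eq (he k))
    ((iIndepFun_congr he).1 hind) (fun k => by rw [← integral_congr_ae (he k), h0 k])
    (by simpa only [variance_congr (he _)] using hs)
  filter_upwards [hmk, ae_all_iff.2 he] with ω ⟨l, hl⟩ hω
  exact ⟨l, by simpa only [hω] using hl⟩

variable {E : Type*} [NormedAddCommGroup E] [InnerProductSpace ℝ E]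

theorem ae_exists_tendsto_sum_of_summable_integral_norm_sq [FiniteDimensional ℝ E]
    [MeasurableSpace E] [BorelSpace E] {Y : ℕ → Ω → E} (hY : ∀ k, MemLp (Y k) 2 μ)
    (hind : iIndepFun Y μ) (h0 : ∀ k, ∫ ω, Y k ω ∂μ = 0)
    (hs : Summable fun k => ∫ ω, ‖Y k ω‖ ^ 2 ∂μ) :
    ∀ᵐ ω ∂μ, ∃ l : E, Tendsto (fun N => ∑ k ∈ Finset.range N, Y k ω) atTop (𝓝 l) := by
  have := hind.isProbabilityMeasure
  have := FiniteDimensional.complete ℝ E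
  let b := stdOrthonormalBasis ℝ E
  have hcoord : ∀ i, ∀ᵐ ω ∂μ, ∃ l : ℝ,
      Tendsto (fun N => ∑ k ∈ Finset.range N, inner ℝ (b i) (Y k ω)) atTop (𝓝 l) := fun i => by
    have hL : ∀ k, MemLp (fun ω => inner ℝ (b i) (Y k ω)) 2 μ := fun k => (hY k).const_inner (b i)
    have hmean : ∀ k, ∫ ω, inner ℝ (b i) (Y k ω) ∂μ = 0 := fun k => by
      rw [integral_inner ((hY k).integrable one_le_two), h0, inner_zero_right]
    refine ae_exists_tendsto_sum_of_summable_variance hL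
      (hind.comp (fun _ => inner ℝ (b i)) fun _ => by fun_prop) hmean
      (hs.of_nonneg_of_le (fun k => variance_nonneg _ _) fun k => ?_)
    rw [variance_of_integral_eq_zero (hL k).aestronglyMeasurable.aemeasurable (hmean k)]
    refine integral_mono (hL k).integrable_sq (hY k).integrable_norm_pow' fun ω => ?_
    rw [← sq_abs, ← Real.norm_eq_abs]
    have := norm_inner_le_norm (𝕜 := ℝ) (b i) (Y k ω)
    rw [b.norm_eq_one, one_mul] at this
    exact pow_le_pow_left₀ (norm_nonneg _) this 2
  filter_upwards [ae_all_iff.2 hcoord] with ω hω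
  choose l hl using hω
  refine ⟨∑ i, l i • b i, ?_⟩
  refine (tendsto_finsetSum Finset.univ fun i _ => (hl i).smul_const (b i)).congr fun N => ?_
  simp only [← inner_sum, b.sum_repr']

end RandomSeries

section OrthogonalSeries

variable {H : Type*} [NormedAddCommGroup H] [InnerProductSpace ℝ H]

theorem hasSum_and_norm_sq_of_pairwise_inner_eq_zero [CompleteSpace H] {f : ℕ → H}
    (hf : Pairwise fun i j => inner ℝ (f i) (f j) = 0) (hs : Summable fun k => ‖f k‖ ^ 2) :
    ∃ F : H, HasSum f F ∧ HasSum (fun k => ‖f k‖ ^ 2) (‖F‖ ^ 2) := by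
  have hV : OrthogonalFamily ℝ (fun k => ℝ ∙ f k) fun k => (ℝ ∙ f k).subtypeₗᵢ :=
    OrthogonalFamily.of_pairwise fun i j hij => by
      simpa [Function.onFun, Submodule.isOrtho_span] using hf hij
  let v : ∀ k, ℝ ∙ f k := fun k => ⟨f k, Submodule.mem_span_singleton_self _⟩
  obtain ⟨F, hF⟩ := (hV.summable_iff_norm_sq_summable v).2 hs
  refine ⟨F, hF, (hF.norm.pow 2).congr fun s => ?_⟩
  exact hV.norm_sum v s

variable {Ω : Type*} [MeasurableSpace Ω] {μ : Measure Ω} {T : ℕ → Ω → H}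

/-- The `L²` limit of the series agrees with its almost everywhere limit, because both are limits
in measure. -/
theorem memLp_and_hasSum_integral_norm_sq_of_orthogonal [CompleteSpace H] [IsFiniteMeasure μ]
    (hT : ∀ k, MemLp (T k) 2 μ)
    (horth : Pairwise fun j k => ∫ ω, inner ℝ (T j ω) (T k ω) ∂μ = 0)
    (hs : Summable fun k => ∫ ω, ‖T k ω‖ ^ 2 ∂μ) {S : Ω → H}
    (hS : ∀ᵐ ω ∂μ, Tendsto (fun N => ∑ k ∈ Finset.range N, T k ω) atTop (𝓝 (S ω))) :
    MemLp S 2 μ ∧ HasSum (fun k => ∫ ω, ‖T k ω‖ ^ 2 ∂μ) (∫ ω, ‖S ω‖ ^ 2 ∂μ) := by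
  have hinner : ∀ {f g : Ω → H} (hf : MemLp f 2 μ) (hg : MemLp g 2 μ),
      inner ℝ hf.toLp hg.toLp = ∫ ω, inner ℝ (f ω) (g ω) ∂μ := fun hf hg => by
    rw [L2.inner_def]
    refine integral_congr_ae ?_
    filter_upwards [hf.coeFn_toLp, hg.coeFn_toLp] with ω hfω hgω
    rw [hfω, hgω]
  have hnorm : ∀ {f : Ω → H} (hf : MemLp f 2 μ), ‖hf.toLp‖ ^ 2 = ∫ ω, ‖f ω‖ ^ 2 ∂μ := fun hf => by
    simp only [← real_inner_self_eq_norm_sq, hinner]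
  obtain ⟨F, hF, hF2⟩ := hasSum_and_norm_sq_of_pairwise_inner_eq_zero
    (f := fun k => (hT k).toLp) (fun j k hjk => by simpa only [hinner] using horth hjk)
    (by simpa only [hnorm] using hs)
  have hpartial : ∀ N, (∑ k ∈ Finset.range N, (hT k).toLp : Lp H 2 μ) =ᵐ[μ]
      fun ω => ∑ k ∈ Finset.range N, T k ω := fun N => by
    filter_upwards [Lp.coeFn_fun_finsetSum (Finset.range N) fun k => (hT k).toLp,
      ae_all_iff.2 fun k => (hT k).coeFn_toLp] with ω hω hTω
    simp only [hω, hTω]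
  have hFS : F =ᵐ[μ] S :=
    tendstoInMeasure_ae_unique
      ((tendstoInMeasure_of_tendsto_Lp hF.tendsto_sum_nat).congr_left hpartial)
      (tendstoInMeasure_of_tendsto_ae (fun N => (memLp_finsetSum _ fun k _ => hT k).1) hS)
  have hmem : MemLp S 2 μ := (Lp.memLp F).ae_eq hFS
  rw [Lp.ext (hFS.trans hmem.coeFn_toLp.symm)] at hF2
  exact ⟨hmem, by simpa only [hnorm] using hF2⟩

end OrthogonalSeries

section PoissonDistribution

theorem natCast_succ_mul_poissonMeasure_singleton (r : NNReal) (n : ℕ) :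
    ((n + 1 : ℕ) : ENNReal) * poissonMeasure r {n + 1} = r * poissonMeasure r {n} := by
  rw [poissonMeasure_singleton, poissonMeasure_singleton, ← ENNReal.ofReal_natCast,
    ← ENNReal.ofReal_coe_nnreal, ← ENNReal.ofReal_mul (by positivity),
    ← ENNReal.ofReal_mul (by positivity), Nat.factorial_succ]
  congr 1
  push_cast
  field_simp
  ring

theorem lintegral_natCast_poissonMeasure (r : NNReal) :
    ∫⁻ n : ℕ, (n : ENNReal) ∂(poissonMeasure r) = r := by
  have htotal : ∑' n, poissonMeasure r {n} = 1 := by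
    simpa using (lintegral_countable' (μ := poissonMeasure r) fun _ => 1).symm
  rw [lintegral_countable', tsum_eq_zero_add' ENNReal.summable, Nat.cast_zero, zero_mul, zero_add]
  simp only [natCast_succ_mul_poissonMeasure_singleton]
  rw [ENNReal.tsum_mul_left, htotal, mul_one]

theorem integral_pow_poissonMeasure (r : NNReal) (z : ℂ) :
    ∫ n : ℕ, z ^ n ∂(poissonMeasure r) = Complex.exp (r * (z - 1)) := by
  have hexp := (NormedSpace.expSeries_div_hasSum_exp ((r : ℂ) * z)).mul_left (Complex.exp (-r))
  rw [← Complex.exp_eq_exp_ℂ, ← Complex.exp_add] at hexp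
  rw [integral_poissonMeasure, mul_sub, mul_one, sub_eq_neg_add, ← hexp.tsum_eq]
  refine tsum_congr fun n => ?_
  rw [Complex.real_smul]
  push_cast
  ring

end PoissonDistribution

theorem norm_prod_sub_prod_le {ι R : Type*} [NormedCommRing R] [NormOneClass R] (s : Finset ι)
    {a b : ι → R} (ha : ∀ i ∈ s, ‖a i‖ ≤ 1) (hb : ∀ i ∈ s, ‖b i‖ ≤ 1) :
    ‖∏ i ∈ s, a i - ∏ i ∈ s, b i‖ ≤ ∑ i ∈ s, ‖a i - b i‖ := by
  classical
  induction s using Finset.induction_on with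
  | empty => simp
  | insert j s hj ih =>
    rw [Finset.prod_insert hj, Finset.prod_insert hj, Finset.sum_insert hj]
    have hprod : ‖∏ i ∈ s, b i‖ ≤ 1 := (s.norm_prod_le b).trans
      (Finset.prod_le_one (fun _ _ => norm_nonneg _) fun i hi => hb i (Finset.mem_insert_of_mem hi))
    have hrest := ih (fun i hi => ha i (Finset.mem_insert_of_mem hi))
      fun i hi => hb i (Finset.mem_insert_of_mem hi)
    calc ‖a j * ∏ i ∈ s, a i - b j * ∏ i ∈ s, b i‖
        = ‖(a j - b j) * ∏ i ∈ s, b i + a j * (∏ i ∈ s, a i - ∏ i ∈ s, b i)‖ := by ring_nf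
      _ ≤ ‖a j - b j‖ * ‖∏ i ∈ s, b i‖ + ‖a j‖ * ‖∏ i ∈ s, a i - ∏ i ∈ s, b i‖ :=
        (norm_add_le _ _).trans (add_le_add (norm_mul_le _ _) (norm_mul_le _ _))
      _ ≤ ‖a j - b j‖ * 1 + 1 * ∑ i ∈ s, ‖a i - b i‖ := by
        gcongr
        exact ha j (Finset.mem_insert_self j s)
      _ = ‖a j - b j‖ + ∑ i ∈ s, ‖a i - b i‖ := by rw [mul_one, one_mul]

section PointProcess

theorem toENNReal_pointCount {Ω : Type*} (x : ℕ → Ω → Plane) (B : Set Plane) (ω : Ω) :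
    (pointCount x B ω : ENNReal) = ∑' k, B.indicator (fun _ => (1 : ENNReal)) (x k ω) := by
  rw [pointCount, ← ENNReal.tsum_set_one]
  exact tsum_subtype {k : ℕ | x k ω ∈ B} (fun _ => (1 : ENNReal))

namespace IsPoissonPointProcess

variable {Ω : Type*} [MeasurableSpace Ω] {μ : Measure Ω} {Λ : Measure Plane} {x : ℕ → Ω → Plane}

theorem isProbabilityMeasure (hx : IsPoissonPointProcess μ Λ x) : IsProbabilityMeasure μ :=
  (hx.indep_count 0 Fin.elim0 (fun i => i.elim0) fun i => i.elim0).isProbabilityMeasure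

theorem lintegral_pointCount [IsLocallyFiniteMeasure Λ] (hx : IsPoissonPointProcess μ Λ x)
    {B : Set Plane} (hB : MeasurableSet B) (hb : Bornology.IsBounded B) :
    ∫⁻ ω, (pointCount x B ω : ENNReal) ∂μ = Λ B := by
  rw [(hx.hasLaw_count B hB hb).lintegral_comp (f := fun n : ℕ∞ => (n : ENNReal))
    Measurable.of_discrete.aemeasurable, lintegral_map .of_discrete .of_discrete]
  simp only [ENat.toENNReal_coe]
  rw [lintegral_natCast_poissonMeasure, ENNReal.coe_toNNReal hb.measure_lt_top.ne]

theorem ae_finite_setOf_mem (hx : IsPoissonPointProcess μ Λ x) {B : Set Plane}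
    (hB : MeasurableSet B) (hb : Bornology.IsBounded B) : ∀ᵐ ω ∂μ, {k | x k ω ∈ B}.Finite := by
  have hfin : ∀ᵐ ω ∂μ, pointCount x B ω ≠ ⊤ := by
    refine ((hx.hasLaw_count B hB hb).ae_iff (p := fun n : ℕ∞ => n ≠ ⊤) .of_discrete).2 ?_
    rw [ae_map_iff .of_discrete .of_discrete]
    exact ae_of_all _ fun n => ENat.natCast_ne_top n
  filter_upwards [hfin] with ω hω using Set.encard_ne_top_iff.1 hω

/-- Campbell's theorem: the mean measure of the process is its intensity measure. -/
theorem sum_map_eq [IsLocallyFiniteMeasure Λ] (hx : IsPoissonPointProcess μ Λ x) :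
    Measure.sum (fun k => μ.map (x k)) = Λ := by
  have hbounded : ∀ A, MeasurableSet A → Bornology.IsBounded A →
      Measure.sum (fun k => μ.map (x k)) A = Λ A := fun A hA hb => by
    have hone : Measurable (A.indicator fun _ => (1 : ENNReal)) := measurable_const.indicator hA
    rw [← hx.lintegral_pointCount hA hb, Measure.sum_apply _ hA]
    simp only [toENNReal_pointCount]
    have hmeas : ∀ k, Measurable fun ω => A.indicator (fun _ => (1 : ENNReal)) (x k ω) :=
      fun k => hone.comp (hx.measurable k)
    rw [lintegral_tsum fun k => (hmeas k).aemeasurable]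
    refine tsum_congr fun k => ?_
    rw [← lintegral_map hone (hx.measurable k), lintegral_indicator_const hA, one_mul]
  ext A hA
  have hmono : Monotone fun R : ℕ => A ∩ Metric.ball (0 : Plane) (R : ℝ) := fun a b hab =>
    Set.inter_subset_inter_right _ (Metric.ball_subset_ball (Nat.cast_le.2 hab))
  rw [← Set.inter_univ A, ← Metric.iUnion_ball_nat (0 : Plane), Set.inter_iUnion,
    hmono.measure_iUnion, hmono.measure_iUnion]
  exact iSup_congr fun R => hbounded _ (hA.inter measurableSet_ball)
    (Metric.isBounded_ball.subset Set.inter_subset_right)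

variable {E : Type*} [NormedAddCommGroup E] [IsLocallyFiniteMeasure Λ]

theorem integrable_comp (hx : IsPoissonPointProcess μ Λ x) {f : Plane → E}
    (hf : Integrable f Λ) (k : ℕ) : Integrable (fun ω => f (x k ω)) μ := by
  rw [← hx.sum_map_eq] at hf
  exact (hf.mono_measure (Measure.le_sum _ k)).comp_measurable (hx.measurable k)

theorem hasSum_integral_comp [NormedSpace ℝ E] (hx : IsPoissonPointProcess μ Λ x)
    {f : Plane → E} (hf : Integrable f Λ) :
    HasSum (fun k => ∫ ω, f (x k ω) ∂μ) (∫ y, f y ∂Λ) := by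
  rw [← hx.sum_map_eq] at hf
  have hsum := hasSum_integral_measure hf
  rw [hx.sum_map_eq] at hsum
  refine hsum.congr_fun fun k => ?_
  exact (integral_map (hx.measurable k).aemeasurable
    (hf.mono_measure (Measure.le_sum _ k)).aestronglyMeasurable).symm

theorem ae_summable_norm_comp (hx : IsPoissonPointProcess μ Λ x) {f : Plane → E}
    (hf : Integrable f Λ) : ∀ᵐ ω ∂μ, Summable fun k => ‖f (x k ω)‖ := by
  have hmeas : ∀ k, AEMeasurable (fun ω => ‖f (x k ω)‖ₑ) μ := fun k =>
    (hx.integrable_comp hf k).aestronglyMeasurable.enorm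
  have hfin : ∫⁻ ω, ∑' k, ‖f (x k ω)‖ₑ ∂μ ≠ ⊤ := by
    rw [lintegral_tsum hmeas]
    rw [← hx.sum_map_eq] at hf
    convert hf.2.ne using 1
    rw [lintegral_sum_measure]
    refine tsum_congr fun k => Eq.symm ?_
    refine lintegral_map' (f := fun y => ‖f y‖ₑ) ?_ (hx.measurable k).aemeasurable
    exact (hf.mono_measure (Measure.le_sum _ k)).aestronglyMeasurable.enorm
  filter_upwards [ae_lt_top' (AEMeasurable.tsum hmeas) hfin] with ω hω
  simpa only [toReal_enorm] using ENNReal.summable_toReal hω.ne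

end IsPoissonPointProcess

end PointProcess

section GeneratingFunctional

/-- A product over the finitely many points in `B` groups into powers of the values of the step
function, with the numbers of points in its level sets as exponents. -/
theorem eventually_prod_one_sub_indicator_eq {Ω : Type*} (x : ℕ → Ω → Plane)
    (B : Set Plane) (U : SimpleFunc Plane ℂ) {ω : Ω} (hω : {k | x k ω ∈ B}.Finite) :
    ∀ᶠ N in atTop, ∏ k ∈ Finset.range N, (1 - B.indicator U (x k ω)) =
      ∏ z : U.range, (1 - (z : ℂ)) ^ (pointCount x (U ⁻¹' {(z : ℂ)} ∩ B) ω).toNat := by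
  classical
  obtain ⟨n, hn⟩ := hω.bddAbove
  filter_upwards [eventually_gt_atTop n] with N hN
  have hsub : hω.toFinset ⊆ Finset.range N := fun k hk =>
    Finset.mem_range.2 ((hn (hω.mem_toFinset.1 hk)).trans_lt hN)
  have hcount : ∀ z : ℂ, (pointCount x (U ⁻¹' {z} ∩ B) ω).toNat =
      (hω.toFinset.filter fun k => U (x k ω) = z).card := fun z => by
    rw [pointCount, ← ENat.toNat_natCast (Finset.card _), ← Set.encard_coe_eq_coe_finsetCard]
    refine congrArg (fun s : Set ℕ => s.encard.toNat) (Set.ext fun k => ?_)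
    simp [and_comm]
  rw [← Finset.prod_subset hsub fun k _ hk => by
    rw [Set.indicator_of_notMem (by simpa using hk), sub_zero]]
  calc ∏ k ∈ hω.toFinset, (1 - B.indicator U (x k ω))
      = ∏ k ∈ hω.toFinset, (1 - U (x k ω)) := Finset.prod_congr rfl fun k hk => by
        rw [Set.indicator_of_mem (by simpa using hk)]
    _ = ∏ z ∈ U.range, ∏ k ∈ hω.toFinset with U (x k ω) = z, (1 - z) :=
        (Finset.prod_fiberwise_of_maps_to' (fun k _ => U.mem_range_self _) _).symm
    _ = ∏ z : U.range, (1 - (z : ℂ)) ^ (pointCount x (U ⁻¹' {(z : ℂ)} ∩ B) ω).toNat := by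
        rw [← Finset.prod_coe_sort]
        simp only [Finset.prod_const, hcount]

theorem exists_simpleFunc_indicator_ball_tendsto {u : Plane → ℂ} (hm : Measurable u)
    (hu : ∀ y, ‖1 - u y‖ ≤ 1) :
    ∃ U : ℕ → SimpleFunc Plane ℂ, (∀ (n : ℕ) y, ‖1 - U n y‖ ≤ 1) ∧
      (∀ (n : ℕ) y, ‖(Metric.ball 0 (n : ℝ)).indicator (U n) y‖ ≤ 2 * ‖u y‖) ∧
      ∀ y, Tendsto (fun n : ℕ => (Metric.ball 0 (n : ℝ)).indicator (U n) y) atTop (𝓝 (u y)) := by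
  let s : Set ℂ := {z | ‖1 - z‖ ≤ 1}
  have h0 : (0 : ℂ) ∈ s := by simp [s]
  refine ⟨SimpleFunc.approxOn u hm s 0 h0, fun n y => SimpleFunc.approxOn_mem hm h0 n y,
    fun n y => ?_, fun y => ?_⟩
  · refine (norm_indicator_le_norm_self _ _).trans ?_
    rw [two_mul]
    exact SimpleFunc.norm_approxOn_zero_le hm h0 y n
  · obtain ⟨N, hN⟩ := exists_nat_gt ‖y‖
    refine (SimpleFunc.tendsto_approxOn hm h0 (subset_closure (hu y))).congr' ?_
    filter_upwards [eventually_ge_atTop N] with n hn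
    refine (Set.indicator_of_mem ?_ _).symm
    exact mem_ball_zero_iff.2 (hN.trans_le (Nat.cast_le.2 hn))

namespace IsPoissonPointProcess

variable {Ω : Type*} [MeasurableSpace Ω] {μ : Measure Ω} {Λ : Measure Plane} {x : ℕ → Ω → Plane}

theorem integral_pow_pointCount (hx : IsPoissonPointProcess μ Λ x) {B : Set Plane}
    (hB : MeasurableSet B) (hb : Bornology.IsBounded B) (z : ℂ) :
    ∫ ω, z ^ (pointCount x B ω).toNat ∂μ = Complex.exp (Λ.real B * (z - 1)) := by
  have h := (hx.hasLaw_count B hB hb).integral_comp (f := fun n : ℕ∞ => z ^ n.toNat)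
    Measurable.of_discrete.aestronglyMeasurable
  rw [Function.comp_def] at h
  rw [h, integral_map .of_discrete Measurable.of_discrete.aestronglyMeasurable]
  simp only [ENat.toNat_natCast]
  exact integral_pow_poissonMeasure _ z

theorem integral_prod_pow_pointCount (hx : IsPoissonPointProcess μ Λ x) {ι : Type*} [Fintype ι]
    {B : ι → Set Plane} (hB : ∀ i, MeasurableSet (B i)) (hb : ∀ i, Bornology.IsBounded (B i))
    (hd : Pairwise (Function.onFun Disjoint B)) (z : ι → ℂ) :
    ∫ ω, ∏ i, z i ^ (pointCount x (B i) ω).toNat ∂μ =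
      Complex.exp (∑ i, Λ.real (B i) * (z i - 1)) := by
  have hind : iIndepFun (fun i => pointCount x (B i)) μ := by
    let e := Fintype.equivFin ι
    have := hx.indep_count _ (fun j => B (e.symm j)) (fun j => hB _)
      fun i j hij => hd (e.symm.injective.ne hij)
    simpa only [Equiv.symm_apply_apply] using this.precomp e.injective
  have hpow := hind.comp (fun i n => z i ^ n.toNat) fun i => .of_discrete
  have hmeas : ∀ i, AEStronglyMeasurable ((fun n : ℕ∞ => z i ^ n.toNat) ∘ pointCount x (B i)) μ :=
    fun i => (Measurable.of_discrete.comp_aemeasurable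
      (hx.hasLaw_count _ (hB i) (hb i)).aemeasurable).aestronglyMeasurable
  rw [Complex.exp_sum]
  exact (hpow.integral_fun_prod_eq_prod_integral hmeas).trans
    (Finset.prod_congr rfl fun i _ => hx.integral_pow_pointCount (hB i) (hb i) (z i))

theorem tendsto_integral_prod_one_sub_indicator [IsLocallyFiniteMeasure Λ]
    (hx : IsPoissonPointProcess μ Λ x) {B : Set Plane} (hB : MeasurableSet B)
    (hb : Bornology.IsBounded B) {U : SimpleFunc Plane ℂ} (hU : ∀ y, ‖1 - U y‖ ≤ 1) :
    Tendsto (fun N => ∫ ω, ∏ k ∈ Finset.range N, (1 - B.indicator U (x k ω)) ∂μ) atTop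
      (𝓝 (Complex.exp (-∫ y, B.indicator U y ∂Λ))) := by
  have := hx.isProbabilityMeasure
  have : Fact (Λ B < ⊤) := ⟨hb.measure_lt_top⟩
  have hlimit : Complex.exp (-∫ y, B.indicator U y ∂Λ) =
      ∫ ω, ∏ z : U.range, (1 - (z : ℂ)) ^ (pointCount x (U ⁻¹' {(z : ℂ)} ∩ B) ω).toNat ∂μ := by
    rw [hx.integral_prod_pow_pointCount (fun z => (U.measurableSet_fiber _).inter hB)
      (fun z => hb.subset Set.inter_subset_right), integral_indicator hB,
      SimpleFunc.integral_eq_sum U (U.integrable_of_isFiniteMeasure), ← Finset.sum_coe_sort]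
    · simp only [sub_sub_cancel_left, mul_neg, Finset.sum_neg_distrib, Complex.real_smul,
        measureReal_restrict_apply (U.measurableSet_fiber _)]
    · refine fun z z' hz => Set.disjoint_left.2 fun y hy hy' => hz (Subtype.ext ?_)
      exact hy.1.symm.trans hy'.1
  rw [hlimit]
  refine tendsto_integral_of_dominated_convergence (fun _ => 1) (fun N => ?_)
    (integrable_const _) (fun N => ae_of_all _ fun ω => ?_) ?_
  · exact (Finset.measurable_fun_prod _ fun k _ => measurable_const.sub
      ((U.measurable.indicator hB).comp (hx.measurable k))).aestronglyMeasurable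
  · refine (Finset.norm_prod_le _ _).trans
      (Finset.prod_le_one (fun _ _ => norm_nonneg _) fun k _ => ?_)
    by_cases hk : x k ω ∈ B
    · simpa only [Set.indicator_of_mem hk] using hU _
    · simp [Set.indicator_of_notMem hk]
  · filter_upwards [hx.ae_finite_setOf_mem hB hb] with ω hω
    exact tendsto_nhds_of_eventually_eq (eventually_prod_one_sub_indicator_eq x B U hω)

theorem norm_integral_prod_sub_integral_prod_le [IsLocallyFiniteMeasure Λ]
    (hx : IsPoissonPointProcess μ Λ x) {v w : Plane → ℂ} (hvm : Measurable v) (hwm : Measurable w)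
    (hv : ∀ y, ‖v y‖ ≤ 1) (hw : ∀ y, ‖w y‖ ≤ 1) (hint : Integrable (fun y => v y - w y) Λ)
    (N : ℕ) :
    ‖∫ ω, ∏ k ∈ Finset.range N, v (x k ω) ∂μ - ∫ ω, ∏ k ∈ Finset.range N, w (x k ω) ∂μ‖ ≤
      ∫ y, ‖v y - w y‖ ∂Λ := by
  have := hx.isProbabilityMeasure
  have hprod : ∀ {u : Plane → ℂ}, Measurable u → (∀ y, ‖u y‖ ≤ 1) →
      Integrable (fun ω => ∏ k ∈ Finset.range N, u (x k ω)) μ := fun hum hu => by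
    refine (integrable_const (1 : ℝ)).mono' (Finset.measurable_fun_prod _ fun k _ =>
      hum.comp (hx.measurable k)).aestronglyMeasurable (ae_of_all _ fun ω => ?_)
    exact (Finset.norm_prod_le _ _).trans
      (Finset.prod_le_one (fun _ _ => norm_nonneg _) fun k _ => hu _)
  have hterm : ∀ k, Integrable (fun ω => ‖v (x k ω) - w (x k ω)‖) μ :=
    hx.integrable_comp hint.norm
  rw [← integral_sub (hprod hvm hv) (hprod hwm hw)]
  calc ‖∫ ω, (∏ k ∈ Finset.range N, v (x k ω) - ∏ k ∈ Finset.range N, w (x k ω)) ∂μ‖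
      ≤ ∫ ω, ∑ k ∈ Finset.range N, ‖v (x k ω) - w (x k ω)‖ ∂μ :=
        norm_integral_le_of_norm_le (integrable_finsetSum _ fun k _ => hterm k)
          (ae_of_all _ fun ω => norm_prod_sub_prod_le _ (fun _ _ => hv _) fun _ _ => hw _)
    _ = ∑ k ∈ Finset.range N, ∫ ω, ‖v (x k ω) - w (x k ω)‖ ∂μ :=
        integral_finsetSum _ fun k _ => hterm k
    _ ≤ ∫ y, ‖v y - w y‖ ∂Λ :=
        sum_le_hasSum _ (fun k _ => integral_nonneg fun _ => norm_nonneg _)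
          (hx.hasSum_integral_comp hint.norm)

theorem tendstoUniformly_integral_prod [IsLocallyFiniteMeasure Λ]
    (hx : IsPoissonPointProcess μ Λ x) {v : Plane → ℂ} {w : ℕ → Plane → ℂ} (hvm : Measurable v)
    (hwm : ∀ n, Measurable (w n)) (hv : ∀ y, ‖v y‖ ≤ 1) (hw : ∀ n y, ‖w n y‖ ≤ 1)
    (hint : ∀ n, Integrable (fun y => v y - w n y) Λ)
    (hlim : Tendsto (fun n => ∫ y, ‖v y - w n y‖ ∂Λ) atTop (𝓝 0)) :
    TendstoUniformly (fun n N => ∫ ω, ∏ k ∈ Finset.range N, w n (x k ω) ∂μ)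
      (fun N => ∫ ω, ∏ k ∈ Finset.range N, v (x k ω) ∂μ) atTop := by
  refine Metric.tendstoUniformly_iff.2 fun ε hε => ?_
  filter_upwards [hlim.eventually (gt_mem_nhds hε)] with n hn N
  rw [dist_eq_norm]
  exact (hx.norm_integral_prod_sub_integral_prod_le hvm (hwm n) hv (hw n) (hint n) N).trans_lt hn

/-- The probability generating functional of a Poisson process. Both sides are continuous in `v`
for the distance `∫ ‖v - w‖ ∂Λ`, uniformly in `N` on the left, and step functions are dense. -/
theorem tendsto_integral_prod [IsLocallyFiniteMeasure Λ]
    (hx : IsPoissonPointProcess μ Λ x) {v : Plane → ℂ} (hm : Measurable v)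
    (hv : ∀ y, ‖v y‖ ≤ 1) (hint : Integrable (fun y => 1 - v y) Λ) :
    Tendsto (fun N => ∫ ω, ∏ k ∈ Finset.range N, v (x k ω) ∂μ) atTop
      (𝓝 (Complex.exp (-∫ y, (1 - v y) ∂Λ))) := by
  obtain ⟨U, hU, hUle, hUlim⟩ := exists_simpleFunc_indicator_ball_tendsto
    (measurable_const.sub hm : Measurable fun y => 1 - v y) (by simpa using hv)
  let u : ℕ → Plane → ℂ := fun n => (Metric.ball 0 (n : ℝ)).indicator (U n)
  have hum : ∀ n, Measurable (u n) := fun n => (U n).measurable.indicator measurableSet_ball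
  have hui : ∀ n, Integrable (u n) Λ := fun n =>
    (hint.norm.const_mul 2).mono' (hum n).aestronglyMeasurable (ae_of_all _ (hUle n))
  have hu1 : ∀ n y, ‖1 - u n y‖ ≤ 1 := fun n y => by
    by_cases hy : y ∈ Metric.ball 0 (n : ℝ)
    · simpa only [u, Set.indicator_of_mem hy] using hU n y
    · simp [u, Set.indicator_of_notMem hy]
  have hexp : Tendsto (fun n => Complex.exp (-∫ y, u n y ∂Λ)) atTop
      (𝓝 (Complex.exp (-∫ y, (1 - v y) ∂Λ))) :=
    (Complex.continuous_exp.tendsto _).comp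
      (tendsto_integral_of_dominated_convergence (fun y => 2 * ‖1 - v y‖)
      (fun n => (hum n).aestronglyMeasurable) (hint.norm.const_mul 2)
      (fun n => ae_of_all _ (hUle n)) (ae_of_all _ hUlim)).neg
  have hsub : ∀ n y, v y - (1 - u n y) = u n y - (1 - v y) := fun n y => by ring
  have hdist : Tendsto (fun n => ∫ y, ‖v y - (1 - u n y)‖ ∂Λ) atTop (𝓝 0) := by
    simp only [hsub]
    rw [← integral_zero Plane ℝ]
    refine tendsto_integral_of_dominated_convergence (fun y => 2 * ‖1 - v y‖ + ‖1 - v y‖)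
      (fun n => ((hum n).sub (measurable_const.sub hm)).norm.aestronglyMeasurable)
      ((hint.norm.const_mul 2).add hint.norm) (fun n => ae_of_all _ fun y => ?_)
      (ae_of_all _ fun y => tendsto_iff_norm_sub_tendsto_zero.1 (hUlim y))
    exact (norm_norm _).trans_le ((norm_sub_le _ _).trans (add_le_add_left (hUle n y) _))
  have hunif := hx.tendstoUniformly_integral_prod hm (fun n => measurable_const.sub (hum n)) hv hu1
    (fun n => ((hui n).sub hint).congr (ae_of_all _ fun y => (hsub n y).symm)) hdist
  exact hunif.tendsto_of_eventually_tendsto (Eventually.of_forall fun n =>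
    hx.tendsto_integral_prod_one_sub_indicator measurableSet_ball Metric.isBounded_ball (hU n)) hexp

end IsPoissonPointProcess

end GeneratingFunctional

section Conditioning

variable {Ω α β : Type*} [MeasurableSpace Ω] [MeasurableSpace α] [MeasurableSpace β]
  {μ : Measure Ω} [IsProbabilityMeasure μ] {X : Ω → α} {Y : Ω → β}

theorem ae_mem_of_indepFun_of_ae_ae_mem (h : IndepFun X Y μ) (hX : AEMeasurable X μ)
    (hY : AEMeasurable Y μ) {C : Set (α × β)} (hC : MeasurableSet C)
    (hae : ∀ᵐ ω ∂μ, ∀ᵐ ω' ∂μ, (X ω, Y ω') ∈ C) : ∀ᵐ ω ∂μ, (X ω, Y ω) ∈ C := by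
  have := Measure.isProbabilityMeasure_map hY
  refine ae_of_ae_map (p := (· ∈ C)) (hX.prodMk hY) ?_
  have hslice : MeasurableSet {a | ∀ᵐ b ∂(μ.map Y), (a, b) ∈ C} :=
    measurable_measure_prodMk_left (ν := μ.map Y) hC.compl (measurableSet_singleton 0)
  rw [h.map_prod_eq_prod_map_map hX hY, Measure.ae_prod_iff_ae_ae (p := (· ∈ C)) hC,
    ae_map_iff hX hslice]
  filter_upwards [hae] with ω hω
  exact (ae_map_iff hY (measurable_prodMk_left hC)).2 hω

theorem integral_comp_prodMk_of_indepFun {E : Type*} [NormedAddCommGroup E] [NormedSpace ℝ E]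
    (h : IndepFun X Y μ) (hX : AEMeasurable X μ) (hY : AEMeasurable Y μ) {F : α × β → E}
    (hF : StronglyMeasurable F) (hint : Integrable (fun ω => F (X ω, Y ω)) μ) :
    ∫ ω, F (X ω, Y ω) ∂μ = ∫ ω, ∫ ω', F (X ω, Y ω') ∂μ ∂μ := by
  have := Measure.isProbabilityMeasure_map hX
  have := Measure.isProbabilityMeasure_map hY
  have hlaw := h.map_prod_eq_prod_map_map hX hY
  have hprod : Integrable F ((μ.map X).prod (μ.map Y)) := by
    rw [← hlaw]
    exact (integrable_map_measure hF.aestronglyMeasurable (hX.prodMk hY)).2 hint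
  rw [← integral_map (hX.prodMk hY) hF.aestronglyMeasurable, hlaw, integral_prod _ hprod,
    integral_map hX hF.integral_prod_right'.aestronglyMeasurable]
  refine integral_congr_ae (ae_of_all _ fun ω => ?_)
  exact integral_map hY (hF.comp_measurable measurable_prodMk_left).aestronglyMeasurable

end Conditioning

section CharFun

theorem norm_exp_ofReal_mul_I_sub_one_sub_le (u : ℝ) :
    ‖Complex.exp (u * Complex.I) - 1 - u * Complex.I‖ ≤ 2 * u ^ 2 := by
  have hu : ‖(u : ℂ) * Complex.I‖ = |u| := by simp
  rcases le_total |u| 1 with h | h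
  · refine (Complex.norm_exp_sub_one_sub_id_le (hu.trans_le h)).trans ?_
    rw [hu, sq_abs]
    linarith [sq_nonneg u]
  · have hexp : ‖Complex.exp (u * Complex.I) - 1‖ ≤ |u| := by
      rw [mul_comm]
      exact Real.norm_exp_I_mul_ofReal_sub_one_le
    calc _ ≤ |u| + |u| := (norm_sub_le _ _).trans (add_le_add hexp hu.le)
      _ ≤ 2 * u ^ 2 := by nlinarith [sq_abs u]

variable {E : Type*} [NormedAddCommGroup E] [InnerProductSpace ℝ E] [MeasurableSpace E]
  [CompleteSpace E] {ν : Measure E} [IsProbabilityMeasure ν]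

theorem norm_one_sub_charFun_le (hν : MemLp id 2 ν) (h0 : ∫ z, z ∂ν = 0) (t : E) :
    ‖1 - charFun ν t‖ ≤ 2 * ‖t‖ ^ 2 * ∫ z, ‖z‖ ^ 2 ∂ν := by
  have hid : Integrable (fun z : E => z) ν := hν.integrable one_le_two
  have hlin : Integrable (fun z : E => (inner ℝ z t : ℂ) * Complex.I) ν :=
    (hid.inner_const t).ofReal.mul_const _
  have hexp : Integrable (fun z => Complex.exp (inner ℝ z t * Complex.I)) ν := by
    refine Integrable.of_bound (C := 1) ?_ (ae_of_all _ fun z => ?_)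
    · exact Complex.continuous_exp.comp_aestronglyMeasurable hlin.1
    · exact (Complex.norm_exp_ofReal_mul_I _).le
  have hlin0 : ∫ z, (inner ℝ z t : ℂ) * Complex.I ∂ν = 0 := by
    rw [integral_mul_const, integral_complex_ofReal]
    simp only [real_inner_comm t]
    rw [integral_inner hid, h0, inner_zero_right, Complex.ofReal_zero, zero_mul]
  have hrem : charFun ν t - 1 =
      ∫ z, (Complex.exp (inner ℝ z t * Complex.I) - 1 - inner ℝ z t * Complex.I) ∂ν := by
    have hexp1 : Integrable (fun z => Complex.exp (inner ℝ z t * Complex.I) - 1) ν :=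
      hexp.sub (integrable_const 1)
    rw [integral_sub hexp1 hlin, hlin0, sub_zero,
      integral_sub hexp (integrable_const _), charFun_apply]
    simp
  rw [norm_sub_rev, hrem, ← integral_const_mul]
  refine norm_integral_le_of_norm_le (hν.integrable_norm_pow'.const_mul _) (ae_of_all _ fun z => ?_)
  refine (norm_exp_ofReal_mul_I_sub_one_sub_le _).trans ?_
  have hcs := abs_real_inner_le_norm z t
  calc 2 * inner ℝ z t ^ 2 ≤ 2 * (‖z‖ * ‖t‖) ^ 2 := by
        gcongr 2 * ?_
        exact sq_le_sq' (neg_le_of_abs_le hcs) (le_of_abs_le hcs)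
    _ = 2 * ‖t‖ ^ 2 * ‖z‖ ^ 2 := by ring

end CharFun

theorem tendsto_charFun_map_of_ae_tendsto {Ω E : Type*} [MeasurableSpace Ω]
    [NormedAddCommGroup E] [InnerProductSpace ℝ E] [SecondCountableTopology E] [MeasurableSpace E]
    [BorelSpace E] {μ : Measure Ω} [IsFiniteMeasure μ] {T : ℕ → Ω → E} {S : Ω → E}
    (hT : ∀ N, AEMeasurable (T N) μ)
    (hS : ∀ᵐ ω ∂μ, Tendsto (fun N => T N ω) atTop (𝓝 (S ω))) (w : E) :
    Tendsto (fun N => charFun (μ.map (T N)) w) atTop (𝓝 (charFun (μ.map S) w)) := by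
  have hSm : AEMeasurable S μ := aemeasurable_of_tendsto_metrizable_ae atTop hT hS
  have hcharFun : ∀ {Y : Ω → E}, AEMeasurable Y μ → charFun (μ.map Y) w =
      ∫ ω, Complex.exp (inner ℝ (Y ω) w * Complex.I) ∂μ := fun hY => by
    rw [charFun_apply, integral_map hY (by fun_prop)]
  simp only [hcharFun hSm, hcharFun (hT _)]
  refine tendsto_integral_of_dominated_convergence (fun _ => 1)
    (fun N => ((by fun_prop : Measurable fun z : E =>
      Complex.exp (inner ℝ z w * Complex.I)).comp_aemeasurable (hT N)).aestronglyMeasurable)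
    (integrable_const 1) (fun N => ae_of_all _ fun ω => (Complex.norm_exp_ofReal_mul_I _).le) ?_
  filter_upwards [hS] with ω hω
  exact ((by fun_prop : Continuous fun z : E =>
    Complex.exp (inner ℝ z w * Complex.I)).tendsto _).comp hω

theorem charFun_map_sum_smul {Ω E : Type*} [MeasurableSpace Ω] [NormedAddCommGroup E]
    [InnerProductSpace ℝ E] [SecondCountableTopology E] [CompleteSpace E] [MeasurableSpace E]
    [BorelSpace E] {μ : Measure Ω} [IsProbabilityMeasure μ] {ν : Measure E} {W : ℕ → Ω → E}
    (hW : ∀ k, HasLaw (W k) ν μ) (hind : iIndepFun W μ) (a : ℕ → ℝ) (s : Finset ℕ) (w : E) :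
    charFun (μ.map fun ω => ∑ k ∈ s, a k • W k ω) w = ∏ k ∈ s, charFun ν (a k • w) := by
  have hterm : ∀ k, AEMeasurable (fun ω => a k • W k ω) μ := fun k =>
    (hW k).aemeasurable.const_smul _
  have hind' : iIndepFun (fun k ω => a k • W k ω) μ :=
    hind.comp (fun k z => a k • z) fun k => measurable_const_smul _
  have hprod := congrFun ((hind'.restrict s).charFun_map_fun_finsetSum_eq_prod
    fun k _ => hterm k) w
  rw [hprod, Finset.prod_apply]
  refine Finset.prod_congr rfl fun k _ => ?_
  rw [charFun_map_smul_comp (hW k).aemeasurable, (hW k).map_eq]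

theorem memLp_of_hasLaw {Ω E : Type*} [MeasurableSpace Ω] [NormedAddCommGroup E]
    [MeasurableSpace E] {μ : Measure Ω} {ν : Measure E} {X : Ω → E} {p : ENNReal}
    (hX : HasLaw X ν μ) (hν : MemLp id p ν) : MemLp X p μ := by
  rw [← hX.map_eq] at hν
  exact (memLp_map_measure_iff hν.1 hX.aemeasurable).1 hν

theorem integral_norm_sq_of_hasLaw {Ω E : Type*} [MeasurableSpace Ω] [NormedAddCommGroup E]
    [MeasurableSpace E] [OpensMeasurableSpace E] {μ : Measure Ω} {ν : Measure E} {X : Ω → E}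
    (hX : HasLaw X ν μ) : ∫ ω, ‖X ω‖ ^ 2 ∂μ = ∫ z, ‖z‖ ^ 2 ∂ν :=
  hX.integral_comp (f := fun z => ‖z‖ ^ 2)
    (continuous_norm.pow 2).measurable.aestronglyMeasurable

/-- The marks `W 0, W 1, …` attached to the points `x 0, x 1, …` are independent of each other and
of all the points, and each has law `ν`. -/
structure IsIndependentMarking {Ω E : Type*} [MeasurableSpace Ω] [MeasurableSpace E]
    (μ : Measure Ω) (ν : Measure E) (x : ℕ → Ω → Plane) (W : ℕ → Ω → E) : Prop where
  hasLaw : ∀ k, HasLaw (W k) ν μ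
  iIndepFun_marks : iIndepFun W μ
  indepFun_points_marks : IndepFun (fun ω k => x k ω) (fun ω k => W k ω) μ

/-- The shot noise at the origin of the first `N` points of `x`, with response function `g` and
marks `W`. -/
def partialShotNoise {Ω E : Type*} [AddCommMonoid E] [SMul ℝ E] (g : Plane → ℝ)
    (x : ℕ → Ω → Plane) (W : ℕ → Ω → E) (N : ℕ) (ω : Ω) : E :=
  ∑ k ∈ Finset.range N, g (x k ω) • W k ω

namespace IsIndependentMarking

section Response

variable {Ω E : Type*} [MeasurableSpace Ω] [NormedAddCommGroup E] [MeasurableSpace E]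
  [BorelSpace E] {μ : Measure Ω} {ν : Measure E} {x : ℕ → Ω → Plane} {W : ℕ → Ω → E}
  {g : Plane → ℝ} {k : ℕ}

theorem indepFun_sq_response_norm_sq (hW : IsIndependentMarking μ ν x W)
    (hg : Measurable g) (k : ℕ) :
    IndepFun (fun ω => g (x k ω) ^ 2) (fun ω => ‖W k ω‖ ^ 2) μ :=
  hW.indepFun_points_marks.comp
    (by fun_prop : Measurable fun a : ℕ → Plane => g (a k) ^ 2)
    (by fun_prop : Measurable fun b : ℕ → E => ‖b k‖ ^ 2)

theorem memLp_two_response_smul [NormedSpace ℝ E] (hW : IsIndependentMarking μ ν x W)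
    (hx : Measurable (x k)) (hg : Measurable g)
    (hint : Integrable (fun ω => g (x k ω) ^ 2) μ) (hν : MemLp id 2 ν) :
    MemLp (fun ω => g (x k ω) • W k ω) 2 μ := by
  have hWk := memLp_of_hasLaw (hW.hasLaw k) hν
  refine (memLp_two_iff_integrable_sq_norm
    ((hg.comp hx).aestronglyMeasurable.smul hWk.aestronglyMeasurable)).2 ?_
  change Integrable (fun ω => ‖g (x k ω) • W k ω‖ ^ 2) μ
  simp only [norm_smul, mul_pow, Real.norm_eq_abs, sq_abs]
  exact (hW.indepFun_sq_response_norm_sq hg k).integrable_mul hint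
    ((memLp_two_iff_integrable_sq_norm hWk.1).1 hWk)

theorem integral_norm_sq_response_smul [NormedSpace ℝ E] (hW : IsIndependentMarking μ ν x W)
    (hx : Measurable (x k)) (hg : Measurable g) :
    ∫ ω, ‖g (x k ω) • W k ω‖ ^ 2 ∂μ = (∫ ω, g (x k ω) ^ 2 ∂μ) * ∫ z, ‖z‖ ^ 2 ∂ν := by
  have hWk := (hW.hasLaw k).aemeasurable
  simp only [norm_smul, mul_pow, Real.norm_eq_abs, sq_abs]
  rw [(hW.indepFun_sq_response_norm_sq hg k).integral_fun_mul_eq_mul_integral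
    ((hg.comp hx).pow_const 2).aestronglyMeasurable
    (hWk.norm.pow_const 2).aestronglyMeasurable,
    integral_norm_sq_of_hasLaw (hW.hasLaw k)]

end Response

section ShotNoise

variable {Ω E : Type*} [MeasurableSpace Ω] [NormedAddCommGroup E] [InnerProductSpace ℝ E]
  [FiniteDimensional ℝ E] [MeasurableSpace E] [BorelSpace E] {μ : Measure Ω}
  {Λ : Measure Plane} {ν : Measure E} {x : ℕ → Ω → Plane} {W : ℕ → Ω → E} {g : Plane → ℝ}
  {S : Ω → E} {j k : ℕ}

theorem ae_exists_tendsto_partialShotNoise [IsProbabilityMeasure μ] [IsLocallyFiniteMeasure Λ]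
    (hW : IsIndependentMarking μ ν x W) (hx : IsPoissonPointProcess μ Λ x) (hg : Measurable g)
    (hg2 : Integrable (fun y => g y ^ 2) Λ) (hν : MemLp id 2 ν) (h0 : ∫ z, z ∂ν = 0) :
    ∀ᵐ ω ∂μ, ∃ l, Tendsto (fun N => partialShotNoise g x W N ω) atTop (𝓝 l) := by
  let sum : ℕ → (ℕ → Plane) × (ℕ → E) → E := fun N p => ∑ k ∈ Finset.range N, g (p.1 k) • p.2 k
  have hsum : ∀ N, StronglyMeasurable (sum N) := fun N =>
    Measurable.stronglyMeasurable (by fun_prop)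
  refine ae_mem_of_indepFun_of_ae_ae_mem hW.indepFun_points_marks
    (aemeasurable_pi_iff.2 fun k => (hx.measurable k).aemeasurable)
    (aemeasurable_pi_iff.2 fun k => (hW.hasLaw k).aemeasurable)
    (StronglyMeasurable.measurableSet_exists_tendsto hsum) ?_
  filter_upwards [hx.ae_summable_norm_comp hg2] with ω hω
  refine ae_exists_tendsto_sum_of_summable_integral_norm_sq (Y := fun k ω' => g (x k ω) • W k ω')
    (fun k => (memLp_of_hasLaw (hW.hasLaw k) hν).const_smul (g (x k ω)))
    (hW.iIndepFun_marks.comp (fun k z => g (x k ω) • z) fun k => measurable_const_smul _)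
    (fun k => ?_) ?_
  · rw [integral_smul, (hW.hasLaw k).integral_eq, h0, smul_zero]
  · have hterm : ∀ k, ∫ ω', ‖g (x k ω) • W k ω'‖ ^ 2 ∂μ =
        ‖g (x k ω) ^ 2‖ * ∫ z, ‖z‖ ^ 2 ∂ν := fun k => by
      simp only [norm_smul, mul_pow, norm_pow]
      rw [integral_const_mul, integral_norm_sq_of_hasLaw (hW.hasLaw k)]
    simpa only [hterm] using hω.mul_right _

theorem aemeasurable_partialShotNoise (hW : IsIndependentMarking μ ν x W)
    (hx : ∀ k, Measurable (x k)) (hg : Measurable g) (N : ℕ) :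
    AEMeasurable (partialShotNoise g x W N) μ :=
  Finset.aemeasurable_fun_sum _ fun k _ =>
    (hg.comp (hx k)).aemeasurable.smul (hW.hasLaw k).aemeasurable

theorem charFun_map_partialShotNoise [IsProbabilityMeasure μ] (hW : IsIndependentMarking μ ν x W)
    (hx : ∀ k, Measurable (x k)) (hg : Measurable g) (N : ℕ) (w : E) :
    charFun (μ.map (partialShotNoise g x W N)) w =
      ∫ ω, ∏ k ∈ Finset.range N, charFun ν (g (x k ω) • w) ∂μ := by
  let F : (ℕ → Plane) × (ℕ → E) → ℂ := fun p =>
    Complex.exp (inner ℝ (∑ k ∈ Finset.range N, g (p.1 k) • p.2 k) w * Complex.I)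
  have hF : StronglyMeasurable F := Measurable.stronglyMeasurable (by fun_prop)
  have hxm : AEMeasurable (fun ω k => x k ω) μ :=
    aemeasurable_pi_iff.2 fun k => (hx k).aemeasurable
  have hWm : AEMeasurable (fun ω k => W k ω) μ :=
    aemeasurable_pi_iff.2 fun k => (hW.hasLaw k).aemeasurable
  have hconditional : ∀ a : ℕ → ℝ,
      ∫ ω', Complex.exp (inner ℝ (∑ k ∈ Finset.range N, a k • W k ω') w * Complex.I) ∂μ =
        ∏ k ∈ Finset.range N, charFun ν (a k • w) := fun a => by
    have hterm : ∀ k, AEMeasurable (W k) μ := fun k => (hW.hasLaw k).aemeasurable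
    rw [← charFun_map_sum_smul hW.hasLaw hW.iIndepFun_marks, charFun_apply,
      integral_map (by fun_prop) (by fun_prop)]
  have hint : Integrable (fun ω => F (fun k => x k ω, fun k => W k ω)) μ :=
    Integrable.of_bound (C := 1) (hF.measurable.comp_aemeasurable
      (hxm.prodMk hWm)).aestronglyMeasurable
      (ae_of_all _ fun ω => (Complex.norm_exp_ofReal_mul_I _).le)
  rw [charFun_apply, integral_map (hW.aemeasurable_partialShotNoise hx hg N) (by fun_prop)]
  refine (integral_comp_prodMk_of_indepFun hW.indepFun_points_marks hxm hWm hF hint).trans ?_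
  simp only [F, hconditional]

theorem charFun_map_of_tendsto_partialShotNoise [IsProbabilityMeasure μ]
    [IsLocallyFiniteMeasure Λ]
    (hW : IsIndependentMarking μ ν x W) (hx : IsPoissonPointProcess μ Λ x) (hg : Measurable g)
    (hg2 : Integrable (fun y => g y ^ 2) Λ) (hν : MemLp id 2 ν) (h0 : ∫ z, z ∂ν = 0)
    (hS : ∀ᵐ ω ∂μ, Tendsto (fun N => partialShotNoise g x W N ω) atTop (𝓝 (S ω))) (w : E) :
    charFun (μ.map S) w = Complex.exp (-∫ y, (1 - charFun ν (g y • w)) ∂Λ) := by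
  have : IsProbabilityMeasure ν := (hW.hasLaw 0).isProbabilityMeasure_iff.1 inferInstance
  have hv : Measurable fun y => charFun ν (g y • w) :=
    measurable_charFun.comp (hg.smul measurable_const)
  have hint : Integrable (fun y => 1 - charFun ν (g y • w)) Λ := by
    refine (hg2.const_mul (2 * ‖w‖ ^ 2 * ∫ z, ‖z‖ ^ 2 ∂ν)).mono'
      (measurable_const.sub hv).aestronglyMeasurable (ae_of_all _ fun y => ?_)
    refine (norm_one_sub_charFun_le hν h0 _).trans_eq ?_
    rw [norm_smul, mul_pow, Real.norm_eq_abs, sq_abs]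
    ring
  refine tendsto_nhds_unique (tendsto_charFun_map_of_ae_tendsto
    (hW.aemeasurable_partialShotNoise hx.measurable hg) hS w) ?_
  simp only [hW.charFun_map_partialShotNoise hx.measurable hg]
  exact hx.tendsto_integral_prod hv (fun y => norm_charFun_le_one _) hint

theorem integral_inner_response_smul_eq_zero (hW : IsIndependentMarking μ ν x W)
    (hxj : Measurable (x j)) (hxk : Measurable (x k)) (hg : Measurable g)
    (hν : Integrable id ν) (h0 : ∫ z, z ∂ν = 0) (hjk : j ≠ k) :
    ∫ ω, inner ℝ (g (x j ω) • W j ω) (g (x k ω) • W k ω) ∂μ = 0 := by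
  have hWi : ∀ i, Integrable (W i) μ := fun i =>
    memLp_one_iff_integrable.1 (memLp_of_hasLaw (hW.hasLaw i) (memLp_one_iff_integrable.2 hν))
  have hmarks : ∫ ω, inner ℝ (W j ω) (W k ω) ∂μ = 0 := by
    refine ((hW.iIndepFun_marks.indepFun hjk).integral_bilin (hWi j) (hWi k)
      (innerSL ℝ)).trans ?_
    rw [(hW.hasLaw j).integral_eq, h0, map_zero, _root_.zero_apply]
  have hind : IndepFun (fun ω => g (x k ω) * g (x j ω)) (fun ω => inner ℝ (W j ω) (W k ω)) μ :=
    hW.indepFun_points_marks.comp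
      (by fun_prop : Measurable fun a : ℕ → Plane => g (a k) * g (a j))
      (by fun_prop : Measurable fun b : ℕ → E => (inner ℝ (b j) (b k) : ℝ))
  simp only [real_inner_smul_left, real_inner_smul_right, ← mul_assoc]
  rw [hind.integral_fun_mul_eq_mul_integral
    ((hg.comp hxk).mul (hg.comp hxj)).aestronglyMeasurable
    ((hWi j).1.inner (hWi k).1), hmarks, mul_zero]

theorem memLp_two_and_integral_norm_sq_of_tendsto_partialShotNoise [IsProbabilityMeasure μ]
    [IsLocallyFiniteMeasure Λ] (hW : IsIndependentMarking μ ν x W)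
    (hx : IsPoissonPointProcess μ Λ x) (hg : Measurable g)
    (hg2 : Integrable (fun y => g y ^ 2) Λ) (hν : MemLp id 2 ν) (h0 : ∫ z, z ∂ν = 0)
    (hS : ∀ᵐ ω ∂μ, Tendsto (fun N => partialShotNoise g x W N ω) atTop (𝓝 (S ω))) :
    MemLp S 2 μ ∧ ∫ ω, ‖S ω‖ ^ 2 ∂μ = (∫ y, g y ^ 2 ∂Λ) * ∫ z, ‖z‖ ^ 2 ∂ν := by
  have : IsProbabilityMeasure ν := (hW.hasLaw 0).isProbabilityMeasure_iff.1 inferInstance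
  have hnorm := fun k => hW.integral_norm_sq_response_smul (hx.measurable k) hg
  have hsum := (hx.hasSum_integral_comp hg2).mul_right (∫ z, ‖z‖ ^ 2 ∂ν)
  obtain ⟨hS2, hS'⟩ := memLp_and_hasSum_integral_norm_sq_of_orthogonal
    (fun k => hW.memLp_two_response_smul (hx.measurable k) hg (hx.integrable_comp hg2 k) hν)
    (fun j k hjk => hW.integral_inner_response_smul_eq_zero (hx.measurable j) (hx.measurable k) hg
      (hν.integrable (by norm_num)) h0 hjk)
    (by simpa only [hnorm] using hsum.summable) hS
  simp only [hnorm] at hS'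
  exact ⟨hS2, hS'.unique hsum⟩

end ShotNoise

end IsIndependentMarking

theorem iIndepFun_curry {Ω ι κ E : Type*} [MeasurableSpace Ω] [MeasurableSpace E] [Countable ι]
    [Countable κ] {μ : Measure Ω} {X : ι × κ → Ω → E} (h : iIndepFun X μ)
    (hX : ∀ p, AEMeasurable (X p) μ) : iIndepFun (fun i ω j => X (i, j) ω) μ := by
  have := h.isProbabilityMeasure
  have : ∀ p, IsProbabilityMeasure (μ.map (X p)) := fun p =>
    Measure.isProbabilityMeasure_map (hX p)
  have hblock : ∀ i, μ.map (fun ω j => X (i, j) ω) =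
      Measure.infinitePi fun j => μ.map (X (i, j)) := fun i =>
    (h.precomp (Prod.mk_right_injective i)).map_fun_eq_infinitePi_map₀' fun j => hX (i, j)
  rw [iIndepFun_iff_map_fun_eq_infinitePi_map₀' fun i => aemeasurable_pi_iff.2 fun j => hX (i, j)]
  simp only [hblock]
  rw [← Measure.infinitePi_map_curry (X := E) fun i j => μ.map (X (i, j)),
    ← h.map_fun_eq_infinitePi_map₀' hX, AEMeasurable.map_map_of_aemeasurable
      (MeasurableEquiv.measurable _).aemeasurable (aemeasurable_pi_iff.2 hX)]
  rfl

theorem iIndepFun_mul_of_iIndepFun_sumElim {Ω ι R : Type*} [MeasurableSpace Ω]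
    [MeasurableSpace R] [Mul R] [MeasurableMul₂ R] [Countable ι] {μ : Measure Ω}
    {s h : ι → Ω → R} (hs : ∀ i, AEMeasurable (s i) μ) (hh : ∀ i, AEMeasurable (h i) μ)
    (hind : iIndepFun (Sum.elim s h) μ) : iIndepFun (fun i ω => s i ω * h i ω) μ := by
  let X : ι × Bool → Ω → R := fun p => Sum.elim s h (if p.2 then .inl p.1 else .inr p.1)
  have hX : iIndepFun X μ := hind.precomp
    (g := fun p : ι × Bool => if p.2 then (.inl p.1 : ι ⊕ ι) else .inr p.1) (by
      rintro ⟨i, _ | _⟩ ⟨j, _ | _⟩ <;> simp)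
  have hXm : ∀ p, AEMeasurable (X p) μ := by
    rintro ⟨i, _ | _⟩
    exacts [hh i, hs i]
  exact (iIndepFun_curry hX hXm).comp (fun _ (b : Bool → R) => b true * b false)
    fun _ => by fun_prop

section SymbolLaw

variable {M : ℕ} (c : Fin M → ℂ)

theorem integral_symbolLaw {E : Type*} [NormedAddCommGroup E] [NormedSpace ℝ E]
    [CompleteSpace E] {f : ℂ → E} (hf : AEStronglyMeasurable f (symbolLaw c)) :
    ∫ z, f z ∂(symbolLaw c) = (M : ℝ)⁻¹ • ∑ m, f (c m) := by
  rw [symbolLaw, integral_map Measurable.of_discrete.aemeasurable hf, uniformOn,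
    ProbabilityTheory.cond, integral_smul_measure, Measure.restrict_univ, integral_count]
  simp

theorem symbolMoment_eq_sum (n : ℕ) : symbolMoment c n = (M : ℝ)⁻¹ * ∑ m, ‖c m‖ ^ n :=
  integral_symbolLaw c (by fun_prop)

instance : IsFiniteMeasure (symbolLaw c) := by
  unfold symbolLaw uniformOn; infer_instance

theorem memLp_id_symbolLaw (p : ENNReal) : MemLp id p (symbolLaw c) := by
  rw [symbolLaw, memLp_map_measure_iff (by fun_prop) Measurable.of_discrete.aemeasurable]
  exact MemLp.of_bound (by fun_prop) (∑ m, ‖c m‖) (ae_of_all _ fun m =>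
    Finset.single_le_sum (f := fun m => ‖c m‖) (fun _ _ => norm_nonneg _) (Finset.mem_univ m))

end SymbolLaw

section ComplexGaussian

instance : IsProbabilityMeasure stdComplexGaussian :=
  Measure.isProbabilityMeasure_map (by fun_prop)

theorem hasLaw_re_stdComplexGaussian :
    HasLaw Complex.re (gaussianReal 0 (1 / 2)) stdComplexGaussian where
  map_eq := by
    rw [stdComplexGaussian, Measure.map_map (by fun_prop) (by fun_prop)]
    simp [Function.comp_def]

theorem hasLaw_im_stdComplexGaussian :
    HasLaw Complex.im (gaussianReal 0 (1 / 2)) stdComplexGaussian where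
  map_eq := by
    rw [stdComplexGaussian, Measure.map_map (by fun_prop) (by fun_prop)]
    simp [Function.comp_def]

theorem memLp_id_stdComplexGaussian : MemLp id 2 stdComplexGaussian :=
  memLp_re_im_iff.1 ⟨memLp_of_hasLaw hasLaw_re_stdComplexGaussian (memLp_id_gaussianReal 2),
    memLp_of_hasLaw hasLaw_im_stdComplexGaussian (memLp_id_gaussianReal 2)⟩

theorem integral_id_stdComplexGaussian : ∫ z, z ∂stdComplexGaussian = 0 := by
  have hint : Integrable id stdComplexGaussian :=
    memLp_id_stdComplexGaussian.integrable (by norm_num)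
  refine (integral_re_add_im hint).symm.trans ?_
  have hre := hasLaw_re_stdComplexGaussian.integral_eq
  have him := hasLaw_im_stdComplexGaussian.integral_eq
  simp [hre, him]

theorem integral_norm_sq_stdComplexGaussian : ∫ z, ‖z‖ ^ 2 ∂stdComplexGaussian = 1 := by
  have hγ : ∫ t, ‖t‖ ^ 2 ∂(gaussianReal 0 (1 / 2)) = 1 / 2 := by
    have hvar := variance_id_gaussianReal (μ := 0) (v := 1 / 2)
    rw [variance_of_integral_eq_zero aemeasurable_id integral_id_gaussianReal] at hvar
    simpa using hvar
  have hre := memLp_of_hasLaw hasLaw_re_stdComplexGaussian (memLp_id_gaussianReal 2)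
  have him := memLp_of_hasLaw hasLaw_im_stdComplexGaussian (memLp_id_gaussianReal 2)
  have hnorm : ∀ z : ℂ, ‖z‖ ^ 2 = ‖z.re‖ ^ 2 + ‖z.im‖ ^ 2 := fun z => by
    rw [Complex.sq_norm, Complex.normSq_apply, Real.norm_eq_abs, Real.norm_eq_abs, sq_abs, sq_abs,
      sq, sq]
  simp only [hnorm]
  rw [integral_add ((memLp_two_iff_integrable_sq_norm hre.1).1 hre)
    ((memLp_two_iff_integrable_sq_norm him.1).1 him),
    integral_norm_sq_of_hasLaw hasLaw_re_stdComplexGaussian,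
    integral_norm_sq_of_hasLaw hasLaw_im_stdComplexGaussian, hγ]
  norm_num

theorem charFun_stdComplexGaussian (w : ℂ) :
    charFun stdComplexGaussian w = Real.exp (-(‖w‖ ^ 2 / 4)) := by
  rw [charFun_apply, stdComplexGaussian, integral_map (by fun_prop) (by fun_prop)]
  have hfactor : ∀ p : ℝ × ℝ, Complex.exp (inner ℝ ((p.1 : ℂ) + (p.2 : ℂ) * Complex.I) w *
      Complex.I) = Complex.exp (w.re * p.1 * Complex.I) *
        Complex.exp (w.im * p.2 * Complex.I) := fun p => by
    rw [← Complex.exp_add, Complex.inner]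
    congr 1
    simp
    ring
  simp only [hfactor]
  rw [integral_prod_mul (fun u : ℝ => Complex.exp (w.re * u * Complex.I))
    (fun u : ℝ => Complex.exp (w.im * u * Complex.I)),
    ← charFun_apply_real, ← charFun_apply_real, charFun_gaussianReal, charFun_gaussianReal,
    ← Complex.exp_add, Complex.ofReal_exp, Complex.sq_norm, Complex.normSq_apply]
  congr 1
  push_cast
  ring

end ComplexGaussian

/-- The law of a faded symbol: the product of an equiprobable symbol of the constellation `c` and
an independent `𝒞𝒩(0, 1)` fading coefficient. -/
noncomputable def fadedSymbolLaw {M : ℕ} (c : Fin M → ℂ) : Measure ℂ :=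
  symbolLaw c ∗ₘ stdComplexGaussian

section FadedSymbol

variable {M : ℕ} (c : Fin M → ℂ)

instance : IsFiniteMeasure (fadedSymbolLaw c) := by unfold fadedSymbolLaw; infer_instance

theorem memLp_id_fadedSymbolLaw : MemLp id 2 (fadedSymbolLaw c) := by
  rw [fadedSymbolLaw, Measure.mconv, memLp_map_measure_iff (by fun_prop) (by fun_prop)]
  exact (memLp_id_stdComplexGaussian.comp_snd _).mul ((memLp_id_symbolLaw c ⊤).comp_fst _)

theorem integral_fadedSymbolLaw {E : Type*} [NormedAddCommGroup E] [NormedSpace ℝ E]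
    [CompleteSpace E] {f : ℂ → E} (hfm : StronglyMeasurable f)
    (hf : Integrable f (fadedSymbolLaw c)) :
    ∫ z, f z ∂(fadedSymbolLaw c) = (M : ℝ)⁻¹ • ∑ m, ∫ z, f (c m * z) ∂stdComplexGaussian := by
  have hfm' : StronglyMeasurable fun p : ℂ × ℂ => f (p.1 * p.2) :=
    hfm.comp_measurable (by fun_prop)
  rw [fadedSymbolLaw, integral_mconv hf,
    integral_symbolLaw c hfm'.integral_prod_right.aestronglyMeasurable]

theorem integral_id_fadedSymbolLaw : ∫ z, z ∂(fadedSymbolLaw c) = 0 := by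
  rw [integral_fadedSymbolLaw c (f := fun z => z) stronglyMeasurable_id
    ((memLp_id_fadedSymbolLaw c).integrable (by norm_num))]
  have hmul (m : Fin M) : ∫ z, c m * z ∂stdComplexGaussian = 0 := by
    rw [integral_const_mul, integral_id_stdComplexGaussian, mul_zero]
  simp only [hmul, Finset.sum_const_zero, smul_zero]

theorem integral_norm_sq_fadedSymbolLaw :
    ∫ z, ‖z‖ ^ 2 ∂(fadedSymbolLaw c) = symbolMoment c 2 := by
  have hLp := memLp_id_fadedSymbolLaw c
  rw [integral_fadedSymbolLaw c (f := fun z => ‖z‖ ^ 2) (by fun_prop)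
    ((memLp_two_iff_integrable_sq_norm hLp.1).1 hLp), symbolMoment_eq_sum]
  simp only [norm_mul, mul_pow, integral_const_mul, integral_norm_sq_stdComplexGaussian, mul_one,
    smul_eq_mul]

theorem charFun_fadedSymbolLaw (w : ℂ) :
    charFun (fadedSymbolLaw c) w =
      ((M : ℝ)⁻¹ * ∑ m, Real.exp (-(‖w‖ ^ 2 * ‖c m‖ ^ 2 / 4)) : ℝ) := by
  have hinner : ∀ v z : ℂ, (inner ℝ (v * z) w : ℝ) = inner ℝ z (starRingEnd ℂ v * w) :=
    fun v z => by
      simp only [Complex.inner, map_mul]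
      congr 1
      ring
  rw [charFun_apply, integral_fadedSymbolLaw c (by fun_prop)
    (Integrable.of_bound (C := 1) (by fun_prop)
      (ae_of_all _ fun z => (Complex.norm_exp_ofReal_mul_I _).le))]
  simp only [hinner, ← charFun_apply, charFun_stdComplexGaussian, norm_mul, RCLike.norm_conj,
    mul_pow, mul_comm (‖c _‖ ^ 2)]
  rw [Complex.real_smul]
  push_cast
  rfl

end FadedSymbol

theorem isIndependentMarking_mul {Ω : Type*} [MeasurableSpace Ω] {μ : Measure Ω} {M : ℕ}
    {c : Fin M → ℂ} {x : ℕ → Ω → Plane} {s h : ℕ → Ω → ℂ}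
    (hs : ∀ k, HasLaw (s k) (symbolLaw c) μ) (hh : ∀ k, HasLaw (h k) stdComplexGaussian μ)
    (hmarks : iIndepFun (Sum.elim s h) μ)
    (hindep : IndepFun (fun ω k => x k ω) (fun ω (j : ℕ ⊕ ℕ) => Sum.elim s h j ω) μ) :
    IsIndependentMarking μ (fadedSymbolLaw c) x fun k ω => s k ω * h k ω where
  hasLaw k := (hmarks.indepFun Sum.inl_ne_inr).hasLaw_fun_mul (hs k) (hh k)
  iIndepFun_marks := iIndepFun_mul_of_iIndepFun_sumElim (fun k => (hs k).aemeasurable)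
    (fun k => (hh k).aemeasurable) hmarks
  indepFun_points_marks := hindep.comp measurable_id
    (by fun_prop : Measurable fun (b : ℕ ⊕ ℕ → ℂ) k => b (.inl k) * b (.inr k))

section Exterior

variable {lam r₀ : ℝ}

instance (lam r₀ : ℝ) : IsLocallyFiniteMeasure (exteriorIntensity lam r₀) :=
  inferInstanceAs (IsLocallyFiniteMeasure
    (lam.toNNReal • (volume : Measure Plane).restrict {y | r₀ < ‖y‖}))

theorem measurableSet_exterior (r₀ : ℝ) : MeasurableSet {y : Plane | r₀ < ‖y‖} :=
  measurableSet_lt measurable_const measurable_norm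

theorem indicator_exterior_comp_norm (g : ℝ → ℝ) (r₀ : ℝ) :
    {y : Plane | r₀ < ‖y‖}.indicator (fun y => g ‖y‖) =
      fun y => (Set.Ioi r₀).indicator g ‖y‖ :=
  rfl

theorem pow_finrank_plane_smul_indicator (g : ℝ → ℝ) (r₀ r : ℝ) :
    r ^ (Module.finrank ℝ Plane - 1) • (Set.Ioi r₀).indicator g r =
      (Set.Ioi r₀).indicator (fun r => r * g r) r := by
  simp [Set.indicator]

theorem integrable_comp_norm_exteriorIntensity {g : ℝ → ℝ}
    (hg : IntegrableOn (fun r => r * g r) (Set.Ioi r₀)) :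
    Integrable (fun y : Plane => g ‖y‖) (exteriorIntensity lam r₀) := by
  refine Integrable.smul_measure ?_ ENNReal.ofReal_ne_top
  rw [← IntegrableOn, ← integrable_indicator_iff (measurableSet_exterior r₀),
    indicator_exterior_comp_norm, integrable_fun_norm_addHaar]
  simp only [pow_finrank_plane_smul_indicator]
  exact ((integrable_indicator_iff measurableSet_Ioi).2 hg).integrableOn

theorem integral_comp_norm_exteriorIntensity (g : ℝ → ℝ) (hlam : 0 ≤ lam) (hr₀ : 0 ≤ r₀) :
    ∫ y : Plane, g ‖y‖ ∂(exteriorIntensity lam r₀) =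
      2 * Real.pi * lam * ∫ r in Set.Ioi r₀, r * g r := by
  rw [exteriorIntensity, integral_smul_measure, ← integral_indicator (measurableSet_exterior r₀),
    indicator_exterior_comp_norm, integral_fun_norm_addHaar]
  simp only [pow_finrank_plane_smul_indicator]
  rw [setIntegral_indicator measurableSet_Ioi,
    Set.inter_eq_self_of_subset_right (Set.Ioi_subset_Ioi hr₀)]
  simp only [Measure.real, EuclideanSpace.volume_ball_fin_two, ENNReal.toReal_ofReal hlam,
    finrank_euclideanSpace, Fintype.card_fin, nsmul_eq_mul, smul_eq_mul]
  simp [Real.pi_nonneg]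
  ring

end Exterior

section Kummer

theorem eval_ascPochhammer_mul_add (a : ℝ) (n : ℕ) :
    (ascPochhammer ℝ n).eval a * (a + n) = a * (ascPochhammer ℝ n).eval (a + 1) := by
  induction n with
  | zero => simp
  | succ n ih =>
    rw [ascPochhammer_succ_eval, ascPochhammer_succ_eval, ih]
    push_cast
    ring

theorem eval_ascPochhammer_div_eval_add_one {a : ℝ} (ha : ∀ n : ℕ, a + n ≠ 0) (n : ℕ) :
    (ascPochhammer ℝ n).eval a / (ascPochhammer ℝ n).eval (a + 1) = a / (a + n) := by
  have hne : (ascPochhammer ℝ n).eval (a + 1) ≠ 0 := fun h => by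
    obtain ⟨k, -, hk⟩ := (ascPochhammer_eval_eq_zero_iff n (a + 1)).1 h
    exact ha (k + 1) (by push_cast; linarith)
  rw [div_eq_div_iff hne (ha n), eval_ascPochhammer_mul_add]

theorem hasSum_kummer_add_one {a : ℝ} (ha : ∀ n : ℕ, a + n ≠ 0) (z : ℝ) :
    HasSum (fun n : ℕ => a / (a + n) * (z ^ n / n !)) (kummer a (a + 1) z) := by
  simp only [kummer, eval_ascPochhammer_div_eval_add_one ha]
  have hlim : Tendsto (fun n : ℕ => a / (a + n)) atTop (𝓝 0) :=
    (tendsto_atTop_add_const_left atTop a tendsto_natCast_atTop_atTop).const_div_atTop a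
  refine (summable_of_isBigO_nat (Real.summable_pow_div_factorial |z|) ?_).hasSum
  refine ((hlim.isBigO_one ℝ).mul (Asymptotics.isBigO_of_le _ fun n => ?_)).congr_right
    fun n => one_mul _
  simp

theorem hasSum_pnat_pow_div_kummer {p η : ℝ} (hp : 0 < p) (hη : p < η) (z : ℝ) :
    HasSum (fun k : ℕ+ => z ^ (k : ℕ) / ((η * (k : ℕ) - p) * (k : ℕ)!))
      ((1 - kummer (-(p / η)) (1 - p / η) z) / p) := by
  have hη0 : 0 < η := hp.trans hη
  have hne (n : ℕ) : -(p / η) + n ≠ 0 := by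
    rcases n.eq_zero_or_pos with rfl | hn
    · simpa using ⟨hp.ne', hη0.ne'⟩
    · have hlt : p / η < 1 := (div_lt_one hη0).2 hη
      have hn1 : (1 : ℝ) ≤ n := Nat.one_le_cast.2 hn
      linarith
  have h0 : -(p / η) / (-(p / η) + (0 : ℕ)) * (z ^ 0 / (0 !)) = 1 := by
    simpa using div_self (hne 0)
  have hsum : HasSum (fun k : ℕ+ => -(p / η) / (-(p / η) + (k : ℕ)) * (z ^ (k : ℕ) / (k : ℕ)!))
      (kummer (-(p / η)) (-(p / η) + 1) z - 1) := by
    rw [hasSum_pnat_iff (f := fun n : ℕ => -(p / η) / (-(p / η) + n) * (z ^ n / n !)), h0,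
      sub_add_cancel]
    exact hasSum_kummer_add_one hne z
  have hval : (1 - kummer (-(p / η)) (1 - p / η) z) / p =
      -p⁻¹ * (kummer (-(p / η)) (-(p / η) + 1) z - 1) := by
    rw [neg_add_eq_sub]
    ring
  rw [hval]
  refine (hsum.mul_left (-p⁻¹)).congr_fun fun k => ?_
  have hk : -(p / η) + (k : ℕ) = (η * (k : ℕ) - p) / η := by field_simp; ring
  have hk0 : η * (k : ℕ) - p ≠ 0 := fun h => hne k (by rw [hk, h, zero_div])
  rw [hk]
  field_simp

theorem hasSum_pnat_pow_div_factorial (z : ℝ) :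
    HasSum (fun k : ℕ+ => z ^ (k : ℕ) / (k : ℕ)!) (Real.exp z - 1) := by
  rw [hasSum_pnat_iff (f := fun n : ℕ => z ^ n / n !)]
  simpa [Real.exp_eq_exp_ℝ] using NormedSpace.expSeries_div_hasSum_exp z

end Kummer

section RadialIntegral

variable {p η r₀ : ℝ}

theorem rpow_sub_one_mul_rpow_neg_pow {r : ℝ} (hr : 0 < r) (k : ℕ) :
    r ^ (p - 1) * (r ^ (-η)) ^ k = r ^ (p - 1 - η * k) := by
  rw [← Real.rpow_mul_natCast hr.le, ← Real.rpow_add hr, neg_mul, ← sub_eq_add_neg]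

theorem integrableOn_Ioi_rpow_mul_pow {k : ℕ} (hk : p < η * k) (hr₀ : 0 < r₀) (A : ℝ) :
    IntegrableOn (fun r : ℝ => r ^ (p - 1) * ((A * r ^ (-η)) ^ k / k !)) (Set.Ioi r₀) := by
  refine IntegrableOn.congr_fun ((integrableOn_Ioi_rpow_of_lt
    (by linarith : p - 1 - η * k < -1) hr₀).const_mul (A ^ k / k !)) (fun r hr => ?_)
    measurableSet_Ioi
  rw [← rpow_sub_one_mul_rpow_neg_pow (hr₀.trans hr), mul_pow]
  ring

theorem integral_Ioi_rpow_mul_pow {k : ℕ} (hk : p < η * k) (hr₀ : 0 < r₀) (A : ℝ) :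
    ∫ r in Set.Ioi r₀, r ^ (p - 1) * ((A * r ^ (-η)) ^ k / k !) =
      r₀ ^ p * ((A / r₀ ^ η) ^ k / ((η * k - p) * k !)) := by
  have hpow : ∫ r in Set.Ioi r₀, r ^ (p - 1 - η * k) =
      r₀ ^ p * (r₀ ^ η)⁻¹ ^ k / (η * k - p) := by
    rw [integral_Ioi_rpow_of_lt (by linarith) hr₀, sub_right_comm, sub_add_cancel,
      Real.rpow_sub hr₀, Real.rpow_mul_natCast hr₀.le, neg_div, ← div_neg, neg_sub, inv_pow,
      div_eq_mul_inv (r₀ ^ p)]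
  calc ∫ r in Set.Ioi r₀, r ^ (p - 1) * ((A * r ^ (-η)) ^ k / k !)
      = ∫ r in Set.Ioi r₀, A ^ k / k ! * r ^ (p - 1 - η * k) :=
        setIntegral_congr_fun measurableSet_Ioi fun r hr => by
          rw [← rpow_sub_one_mul_rpow_neg_pow (hr₀.trans hr), mul_pow]
          ring
    _ = r₀ ^ p * ((A / r₀ ^ η) ^ k / ((η * k - p) * k !)) := by
        rw [integral_const_mul, hpow, div_eq_mul_inv A, mul_pow, div_mul_eq_div_div]
        ring

theorem integral_Ioi_norm_rpow_mul_pow {k : ℕ} (hk : p < η * k) (hr₀ : 0 < r₀) (A : ℝ) :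
    ∫ r in Set.Ioi r₀, ‖r ^ (p - 1) * ((A * r ^ (-η)) ^ k / k !)‖ =
      r₀ ^ p * ((|A| / r₀ ^ η) ^ k / ((η * k - p) * k !)) := by
  rw [← integral_Ioi_rpow_mul_pow hk hr₀]
  refine setIntegral_congr_fun measurableSet_Ioi fun r hr => ?_
  have hr0 : 0 < r := hr₀.trans hr
  simp only [norm_mul, norm_div, norm_pow, Real.norm_rpow_of_nonneg hr0.le, Real.norm_eq_abs,
    abs_of_pos hr0, Nat.abs_cast]

theorem integral_Ioi_rpow_mul_exp_sub_one (hp : 0 < p) (hη : p < η) (hr₀ : 0 < r₀) (A : ℝ) :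
    ∫ r in Set.Ioi r₀, r ^ (p - 1) * (Real.exp (A * r ^ (-η)) - 1) =
      r₀ ^ p * ((1 - kummer (-(p / η)) (1 - p / η) (A / r₀ ^ η)) / p) := by
  have hk (k : ℕ+) : p < η * (k : ℕ) :=
    hη.trans_le (le_mul_of_one_le_right (hp.trans hη).le (Nat.one_le_cast.2 k.pos))
  have hsum := hasSum_integral_of_summable_integral_norm
    (fun k : ℕ+ => integrableOn_Ioi_rpow_mul_pow (hk k) hr₀ A) <| by
      simp only [integral_Ioi_norm_rpow_mul_pow (hk _) hr₀]
      exact (hasSum_pnat_pow_div_kummer hp hη _).summable.mul_left _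
  simp only [integral_Ioi_rpow_mul_pow (hk _) hr₀, tsum_mul_left,
    (hasSum_pnat_pow_div_factorial _).tsum_eq] at hsum
  exact hsum.unique ((hasSum_pnat_pow_div_kummer hp hη _).mul_left _)

end RadialIntegral

section PathGain

variable {lam P η r₀ : ℝ}

/-- The amplitude gain `√P * ‖y‖ ^ (-η / 2)` from a transmitter at `y` to the origin. -/
noncomputable def pathGain (P η : ℝ) (y : Plane) : ℝ := √P * ‖y‖ ^ (-(η / 2))

theorem measurable_pathGain (P η : ℝ) : Measurable (pathGain P η) := by
  unfold pathGain
  fun_prop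

theorem pathGain_sq (hP : 0 ≤ P) (η : ℝ) (y : Plane) :
    pathGain P η y ^ 2 = P * ‖y‖ ^ (-η) := by
  rw [pathGain, mul_pow, Real.sq_sqrt hP, ← Real.rpow_mul_natCast (norm_nonneg _)]
  congr 2
  push_cast
  ring

theorem partialInterference_eq_partialShotNoise {Ω : Type*} (P η : ℝ) (x : ℕ → Ω → Plane)
    (s h : ℕ → Ω → ℂ) (N : ℕ) (ω : Ω) :
    partialInterference P η x s h N ω =
      partialShotNoise (pathGain P η) x (fun k ω => s k ω * h k ω) N ω := by
  refine Finset.sum_congr rfl fun k _ => ?_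
  rw [pathGain, Complex.real_smul]
  push_cast
  ring

theorem mul_rpow_neg_eqOn_rpow (hr₀ : 0 ≤ r₀) :
    Set.EqOn (fun r : ℝ => r * r ^ (-η)) (fun r => r ^ (1 - η)) (Set.Ioi r₀) := fun r hr => by
  simp only [sub_eq_add_neg, Real.rpow_add (hr₀.trans_lt hr), Real.rpow_one]

theorem integrable_norm_rpow_neg_exteriorIntensity (hη : 2 < η) (hr₀ : 0 < r₀) :
    Integrable (fun y : Plane => ‖y‖ ^ (-η)) (exteriorIntensity lam r₀) :=
  integrable_comp_norm_exteriorIntensity (g := fun r => r ^ (-η))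
    ((integrableOn_Ioi_rpow_of_lt (by linarith) hr₀).congr_fun
      (mul_rpow_neg_eqOn_rpow hr₀.le).symm measurableSet_Ioi)

theorem integral_norm_rpow_neg_exteriorIntensity (hlam : 0 ≤ lam) (hη : 2 < η) (hr₀ : 0 < r₀) :
    ∫ y : Plane, ‖y‖ ^ (-η) ∂(exteriorIntensity lam r₀) =
      2 * Real.pi * lam * (r₀ ^ (2 - η) / (η - 2)) := by
  rw [integral_comp_norm_exteriorIntensity (fun r => r ^ (-η)) hlam hr₀.le,
    setIntegral_congr_fun measurableSet_Ioi (mul_rpow_neg_eqOn_rpow hr₀.le),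
    integral_Ioi_rpow_of_lt (by linarith) hr₀, neg_div, ← div_neg]
  ring_nf

theorem integrable_pathGain_sq (hP : 0 ≤ P) (hη : 2 < η) (hr₀ : 0 < r₀) :
    Integrable (fun y => pathGain P η y ^ 2) (exteriorIntensity lam r₀) := by
  simp only [pathGain_sq hP]
  exact (integrable_norm_rpow_neg_exteriorIntensity hη hr₀).const_mul P

theorem integral_pathGain_sq (hlam : 0 ≤ lam) (hP : 0 ≤ P) (hη : 2 < η) (hr₀ : 0 < r₀) :
    ∫ y, pathGain P η y ^ 2 ∂(exteriorIntensity lam r₀) =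
      2 * Real.pi * lam * P * r₀ ^ (2 - η) / (η - 2) := by
  simp only [pathGain_sq hP]
  rw [integral_const_mul, integral_norm_rpow_neg_exteriorIntensity hlam hη hr₀]
  ring

end PathGain

theorem integrable_one_sub_exp_neg {α : Type*} [MeasurableSpace α] {μ : Measure α} {f : α → ℝ}
    (hf : Integrable f μ) (hf0 : ∀ a, 0 ≤ f a) :
    Integrable (fun a => 1 - Real.exp (-f a)) μ := by
  refine hf.mono' (by have := hf.1; fun_prop) (ae_of_all _ fun a => ?_)
  rw [Real.norm_of_nonneg (sub_nonneg.2 (Real.exp_le_one_iff.2 (neg_nonpos.2 (hf0 a))))]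
  linarith [Real.add_one_le_exp (-f a)]

section Exponent

variable {lam P η r₀ : ℝ} {M : ℕ} {c : Fin M → ℂ}

/-- The exponent of the characteristic function of the aggregate interference at a point of
modulus `t`, per unit of `2 * π * lam * r₀ ^ 2`. -/
noncomputable def normalizedExponent (P η r₀ : ℝ) {M : ℕ} (c : Fin M → ℂ) (t : ℝ) : ℝ :=
  (M : ℝ)⁻¹ * ∑ m, (1 - kummer (-(2 / η)) (1 - 2 / η)
    (-(t ^ 2 * P * ‖c m‖ ^ 2 / (4 * r₀ ^ η)))) / 2

theorem normalizedExponent_abs (t : ℝ) :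
    normalizedExponent P η r₀ c |t| = normalizedExponent P η r₀ c t := by
  simp only [normalizedExponent, sq_abs]

theorem mul_normalizedExponent_eq (lam P η r₀ : ℝ) (c : Fin M → ℂ) (t : ℝ) :
    2 * Real.pi * lam * r₀ ^ 2 * normalizedExponent P η r₀ c t =
      Real.pi * lam / M * ∑ m, r₀ ^ 2 * (1 - kummer (-(2 / η)) (1 - 2 / η)
        (-(t ^ 2 * P * ‖c m‖ ^ 2 / (4 * r₀ ^ η)))) := by
  rw [normalizedExponent, ← Finset.mul_sum, ← Finset.sum_div]
  ring

theorem hasSum_normalizedExponent (hη : 2 < η) (t : ℝ) :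
    HasSum (fun k : ℕ+ => (-1 : ℝ) ^ (k : ℕ) * t ^ (2 * (k : ℕ)) *
        symbolMoment c (2 * (k : ℕ)) / ((η * (k : ℕ) - 2) * (k : ℕ)!) *
          (P / (4 * r₀ ^ η)) ^ (k : ℕ))
      (normalizedExponent P η r₀ c t) := by
  refine ((hasSum_sum fun m (_ : m ∈ Finset.univ) => hasSum_pnat_pow_div_kummer two_pos hη
    (-(t ^ 2 * P * ‖c m‖ ^ 2 / (4 * r₀ ^ η)))).mul_left (M : ℝ)⁻¹).congr_fun fun k => ?_
  have hpow (m : Fin M) : (-(t ^ 2 * P * ‖c m‖ ^ 2 / (4 * r₀ ^ η))) ^ (k : ℕ) =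
      (-1 : ℝ) ^ (k : ℕ) * t ^ (2 * (k : ℕ)) * (P / (4 * r₀ ^ η)) ^ (k : ℕ) *
        ‖c m‖ ^ (2 * (k : ℕ)) := by
    rw [pow_mul, pow_mul, ← mul_pow, ← mul_pow, ← mul_pow]
    congr 1
    ring
  simp only [hpow, ← Finset.sum_div, ← Finset.mul_sum]
  rw [symbolMoment_eq_sum]
  ring

theorem integral_one_sub_exp_exteriorIntensity (hlam : 0 ≤ lam) (hη : 2 < η) (hr₀ : 0 < r₀)
    (A : ℝ) :
    ∫ y : Plane, (1 - Real.exp (A * ‖y‖ ^ (-η))) ∂(exteriorIntensity lam r₀) =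
      -(2 * Real.pi * lam * r₀ ^ 2 *
        ((1 - kummer (-(2 / η)) (1 - 2 / η) (A / r₀ ^ η)) / 2)) := by
  have hradial (r : ℝ) : r * (1 - Real.exp (A * r ^ (-η))) =
      -(r ^ ((2 : ℝ) - 1) * (Real.exp (A * r ^ (-η)) - 1)) := by
    norm_num
    ring
  rw [integral_comp_norm_exteriorIntensity (fun r => 1 - Real.exp (A * r ^ (-η))) hlam hr₀.le]
  simp only [hradial]
  rw [integral_neg, integral_Ioi_rpow_mul_exp_sub_one two_pos hη hr₀, Real.rpow_two]
  ring

theorem one_sub_charFun_fadedSymbolLaw (hM : M ≠ 0) (w : ℂ) :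
    1 - charFun (fadedSymbolLaw c) w =
      ((M : ℝ)⁻¹ * ∑ m, (1 - Real.exp (-(‖w‖ ^ 2 * ‖c m‖ ^ 2 / 4))) : ℝ) := by
  rw [charFun_fadedSymbolLaw, Finset.sum_sub_distrib, mul_sub]
  simp [hM]

theorem integral_one_sub_charFun_fadedSymbolLaw (hM : M ≠ 0) (hlam : 0 ≤ lam) (hP : 0 ≤ P)
    (hη : 2 < η) (hr₀ : 0 < r₀) (w : ℂ) :
    ∫ y, (1 - charFun (fadedSymbolLaw c) (pathGain P η y • w)) ∂(exteriorIntensity lam r₀) =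
      (-(2 * Real.pi * lam * r₀ ^ 2 * normalizedExponent P η r₀ c ‖w‖) : ℝ) := by
  have hexp (y : Plane) (m : Fin M) : ‖pathGain P η y • w‖ ^ 2 * ‖c m‖ ^ 2 / 4 =
      ‖w‖ ^ 2 * P * ‖c m‖ ^ 2 / 4 * ‖y‖ ^ (-η) := by
    rw [norm_smul, mul_pow, Real.norm_eq_abs, sq_abs, pathGain_sq hP]
    ring
  have hint (m : Fin M) : Integrable (fun y : Plane =>
      1 - Real.exp (-(‖w‖ ^ 2 * P * ‖c m‖ ^ 2 / 4 * ‖y‖ ^ (-η)))) (exteriorIntensity lam r₀) :=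
    integrable_one_sub_exp_neg ((integrable_norm_rpow_neg_exteriorIntensity hη hr₀).const_mul _)
      fun y => by positivity
  simp only [one_sub_charFun_fadedSymbolLaw hM, hexp]
  rw [integral_complex_ofReal, integral_const_mul, integral_finsetSum _ fun m _ => hint m]
  simp only [← neg_mul, integral_one_sub_exp_exteriorIntensity hlam hη hr₀]
  simp only [normalizedExponent, neg_div, div_div]
  rw [← Finset.mul_sum, mul_left_comm]

end Exponent

section PowerSeries

variable {𝕜 E : Type*} [NontriviallyNormedField 𝕜] [NormedAddCommGroup E] [NormedSpace 𝕜 E]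
  {f : 𝕜 → E} {b : ℕ → E}

theorem exists_hasFPowerSeriesAt_zero_of_hasSum
    (hf : ∀ᶠ t in 𝓝 (0 : 𝕜), HasSum (fun n => t ^ n • b n) (f t)) :
    ∃ p : FormalMultilinearSeries 𝕜 𝕜 E, HasFPowerSeriesAt f p 0 ∧ ∀ n, p.coeff n = b n := by
  let p : FormalMultilinearSeries 𝕜 𝕜 E := fun n => ContinuousMultilinearMap.mkPiRing 𝕜 _ (b n)
  have hp (n : ℕ) : p.coeff n = b n := by simp [p, FormalMultilinearSeries.coeff]
  exact ⟨p, hasFPowerSeriesAt_iff.2 (by simpa only [hp, zero_add] using hf), hp⟩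

variable [CompleteSpace E]

theorem contDiffAt_zero_of_hasSum
    (hf : ∀ᶠ t in 𝓝 (0 : 𝕜), HasSum (fun n => t ^ n • b n) (f t)) {n : WithTop ℕ∞} :
    ContDiffAt 𝕜 n f 0 :=
  let ⟨_, hp, _⟩ := exists_hasFPowerSeriesAt_zero_of_hasSum hf
  hp.analyticAt.contDiffAt

theorem iteratedDeriv_zero_eq_factorial_smul
    (hf : ∀ᶠ t in 𝓝 (0 : 𝕜), HasSum (fun n => t ^ n • b n) (f t)) (n : ℕ) :
    iteratedDeriv n f 0 = n ! • b n := by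
  obtain ⟨p, ⟨r, hr⟩, hp⟩ := exists_hasFPowerSeriesAt_zero_of_hasSum hf
  rw [iteratedDeriv, ← hr.factorial_smul 1 n, ← hp n]
  rfl

end PowerSeries

section Law

variable {Ω : Type*} [MeasurableSpace Ω] {μ : Measure Ω}

theorem charFun_map_inner {E : Type*} [NormedAddCommGroup E] [InnerProductSpace ℝ E]
    [MeasurableSpace E] [BorelSpace E] [SecondCountableTopology E] {Z : Ω → E}
    (hZ : AEMeasurable Z μ) (v : E) (t : ℝ) :
    charFun (μ.map fun ω => inner ℝ v (Z ω)) t = charFun (μ.map Z) (t • v) := by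
  rw [charFun_apply, charFun_apply, integral_map hZ (by fun_prop),
    integral_map (by fun_prop) (by fun_prop)]
  simp only [real_inner_smul_right, real_inner_comm v, RCLike.inner_apply, conj_trivial]

theorem map_const_mul_eq_of_charFun_radial [IsFiniteMeasure μ] {Z : Ω → ℂ}
    (hZ : AEMeasurable Z μ) {f : ℝ → ℂ} (hf : ∀ w, charFun (μ.map Z) w = f ‖w‖) {u : ℂ}
    (hu : ‖u‖ = 1) : μ.map (fun ω => u * Z ω) = μ.map Z := by
  refine Measure.ext_of_charFun (funext fun w => ?_)
  have hmul : charFun (μ.map fun ω => u * Z ω) w = charFun (μ.map Z) (starRingEnd ℂ u * w) := by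
    rw [charFun_apply, charFun_apply, integral_map hZ (by fun_prop),
      integral_map (hZ.const_mul u) (by fun_prop)]
    simp only [Complex.inner, map_mul, mul_assoc, mul_left_comm]
  rw [hmul, hf, hf, norm_mul, RCLike.norm_conj, hu, one_mul]

variable {X : Ω → ℝ} {f : ℝ → ℝ} {a : ℕ+ → ℝ}

theorem logCharFun_eq_of_charFun_eq_exp (hX : ∀ t, charFun (μ.map X) t = (Real.exp (f t) : ℝ)) :
    logCharFun μ X = fun t => (f t : ℂ) := by
  funext t
  rw [logCharFun, hX, ← Complex.ofReal_log (Real.exp_nonneg _), Real.log_exp]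

theorem injective_two_mul_pnat : Function.Injective fun k : ℕ+ => 2 * (k : ℕ) :=
  fun _ _ h => PNat.eq (Nat.eq_of_mul_eq_mul_left two_pos h)

theorem hasSum_logCharFun_of_charFun_eq_exp
    (hX : ∀ t, charFun (μ.map X) t = (Real.exp (f t) : ℝ))
    (hf : ∀ t, HasSum (fun k : ℕ+ => t ^ (2 * (k : ℕ)) * a k) (f t)) (t : ℝ) :
    HasSum (fun n => t ^ n • Function.extend (fun k : ℕ+ => 2 * (k : ℕ)) (fun k => (a k : ℂ)) 0 n)
      (logCharFun μ X t) := by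
  rw [logCharFun_eq_of_charFun_eq_exp hX, ← injective_two_mul_pnat.hasSum_iff fun n hn => by
    rw [Function.extend_apply' _ _ _ hn, Pi.zero_apply, smul_zero]]
  simp only [Function.comp_def, injective_two_mul_pnat.extend_apply, Complex.real_smul,
    ← Complex.ofReal_mul]
  exact Complex.hasSum_ofReal.2 (hf t)

theorem contDiffAt_logCharFun (hX : ∀ t, charFun (μ.map X) t = (Real.exp (f t) : ℝ))
    (hf : ∀ t, HasSum (fun k : ℕ+ => t ^ (2 * (k : ℕ)) * a k) (f t)) (n : WithTop ℕ∞) :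
    ContDiffAt ℝ n (logCharFun μ X) 0 :=
  contDiffAt_zero_of_hasSum (.of_forall (hasSum_logCharFun_of_charFun_eq_exp hX hf))

theorem cumulant_of_odd (hX : ∀ t, charFun (μ.map X) t = (Real.exp (f t) : ℝ))
    (hf : ∀ t, HasSum (fun k : ℕ+ => t ^ (2 * (k : ℕ)) * a k) (f t)) {n : ℕ} (hn : Odd n) :
    cumulant μ X n = 0 := by
  have hne : ¬∃ k : ℕ+, 2 * (k : ℕ) = n := fun ⟨k, hk⟩ =>
    Nat.not_even_iff_odd.2 hn (hk ▸ even_two_mul _)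
  rw [cumulant, iteratedDeriv_zero_eq_factorial_smul
    (.of_forall (hasSum_logCharFun_of_charFun_eq_exp hX hf)), Function.extend_apply' _ _ _ hne]
  simp

theorem cumulant_two_mul (hX : ∀ t, charFun (μ.map X) t = (Real.exp (f t) : ℝ))
    (hf : ∀ t, HasSum (fun k : ℕ+ => t ^ (2 * (k : ℕ)) * a k) (f t)) (k : ℕ+) :
    cumulant μ X (2 * k) = ((-1) ^ (k : ℕ) * (2 * (k : ℕ))! * a k : ℝ) := by
  rw [cumulant, iteratedDeriv_zero_eq_factorial_smul
    (.of_forall (hasSum_logCharFun_of_charFun_eq_exp hX hf)),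
    injective_two_mul_pnat.extend_apply, pow_mul, Complex.I_sq, div_eq_iff (by simp)]
  have hsq : ((-1 : ℂ) ^ (k : ℕ)) * (-1) ^ (k : ℕ) = 1 := by rw [← mul_pow]; norm_num
  push_cast
  rw [nsmul_eq_mul]
  linear_combination (-((2 * (k : ℕ))! : ℂ) * a k) * hsq

end Law

section Cumulants

variable {lam P η r₀ : ℝ} {M : ℕ} {c : Fin M → ℂ}

/-- The coefficient of `‖w‖ ^ (2 * k)` in the exponent of the characteristic function of the
aggregate interference at `w`. -/
noncomputable def exponentCoeff (lam P η r₀ : ℝ) {M : ℕ} (c : Fin M → ℂ) (k : ℕ) : ℝ :=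
  2 * Real.pi * lam * r₀ ^ 2 *
    ((-1) ^ k * symbolMoment c (2 * k) / ((η * k - 2) * k !) * (P / (4 * r₀ ^ η)) ^ k)

theorem hasSum_pow_mul_exponentCoeff (hη : 2 < η) (t : ℝ) :
    HasSum (fun k : ℕ+ => t ^ (2 * (k : ℕ)) * exponentCoeff lam P η r₀ c k)
      (2 * Real.pi * lam * r₀ ^ 2 * normalizedExponent P η r₀ c t) :=
  ((hasSum_normalizedExponent hη t).mul_left _).congr_fun fun k => by
    rw [exponentCoeff]
    ring

theorem factorial_two_mul_mul_exponentCoeff (hr₀ : 0 < r₀) (k : ℕ+) :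
    (-1) ^ (k : ℕ) * (2 * (k : ℕ))! * exponentCoeff lam P η r₀ c k =
      Real.pi * lam * P ^ (k : ℕ) * (2 * (k : ℕ)).descFactorial k /
        (2 ^ (2 * (k : ℕ) - 1) * (η * (2 * (k : ℕ) : ℕ) / 2 - 2)) *
          r₀ ^ (2 - η * (2 * (k : ℕ) : ℕ) / 2) * symbolMoment c (2 * k) := by
  have hfactorial : ((2 * (k : ℕ))! : ℝ) = (k : ℕ)! * (2 * (k : ℕ)).descFactorial k := by
    have h := Nat.factorial_mul_descFactorial (Nat.le_mul_of_pos_left (k : ℕ) two_pos)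
    rw [two_mul, Nat.add_sub_cancel, ← two_mul] at h
    exact_mod_cast h.symm
  have hrpow : r₀ ^ (2 - η * (2 * (k : ℕ) : ℕ) / 2) = r₀ ^ 2 * ((r₀ ^ η) ^ (k : ℕ))⁻¹ := by
    rw [show 2 - η * ((2 * (k : ℕ) : ℕ) : ℝ) / 2 = 2 - η * (k : ℕ) by push_cast; ring,
      Real.rpow_sub hr₀, Real.rpow_mul_natCast hr₀.le, Real.rpow_two, div_eq_mul_inv]
  have hpow : (2 : ℝ) ^ (2 * (k : ℕ) - 1) = 4 ^ (k : ℕ) / 2 := by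
    have hk := k.pos
    rw [eq_div_iff two_ne_zero, ← pow_succ, Nat.sub_add_cancel (by lia), pow_mul]
    norm_num
  have hdenom : η * ((2 * (k : ℕ) : ℕ) : ℝ) / 2 - 2 = η * (k : ℕ) - 2 := by push_cast; ring
  have hsign : ((-1 : ℝ) ^ (k : ℕ)) ^ 2 = 1 := by rw [pow_right_comm]; norm_num
  have hk0 : ((k : ℕ)! : ℝ) ≠ 0 := by positivity
  rw [exponentCoeff, hfactorial, hrpow, hpow, hdenom, div_pow, mul_pow]
  field_simp
  rw [hsign, one_mul]

end Cumulants

theorem ne_zero_of_isProbabilityMeasure_fadedSymbolLaw {M : ℕ} (c : Fin M → ℂ)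
    [IsProbabilityMeasure (fadedSymbolLaw c)] : M ≠ 0 := by
  rintro rfl
  simpa using charFun_fadedSymbolLaw c 0

section AggregateInterference

variable {Ω : Type*} [MeasurableSpace Ω] {μ : Measure Ω} {lam P η r₀ : ℝ}
  {M : ℕ} {c : Fin M → ℂ} {x : ℕ → Ω → Plane} {s h : ℕ → Ω → ℂ}

theorem aemeasurable_aggregateInterference (hx : ∀ k, Measurable (x k))
    (hW : IsIndependentMarking μ (fadedSymbolLaw c) x fun k ω => s k ω * h k ω)
    (hlim : ∀ᵐ ω ∂μ, Tendsto (fun N => partialInterference P η x s h N ω) atTop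
      (𝓝 (aggregateInterference P η x s h ω))) :
    AEMeasurable (aggregateInterference P η x s h) μ := by
  simp only [partialInterference_eq_partialShotNoise] at hlim
  exact aemeasurable_of_tendsto_metrizable_ae atTop
    (hW.aemeasurable_partialShotNoise hx (measurable_pathGain P η)) hlim

variable [IsProbabilityMeasure μ]

theorem ae_tendsto_aggregateInterference (hP : 0 ≤ P) (hη : 2 < η) (hr₀ : 0 < r₀)
    (hx : IsPoissonPointProcess μ (exteriorIntensity lam r₀) x)
    (hW : IsIndependentMarking μ (fadedSymbolLaw c) x fun k ω => s k ω * h k ω) :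
    ∀ᵐ ω ∂μ, Tendsto (fun N => partialInterference P η x s h N ω) atTop
      (𝓝 (aggregateInterference P η x s h ω)) := by
  filter_upwards [hW.ae_exists_tendsto_partialShotNoise hx (measurable_pathGain P η)
    (integrable_pathGain_sq hP hη hr₀) (memLp_id_fadedSymbolLaw c)
    (integral_id_fadedSymbolLaw c)] with ω hω
  simp only [← partialInterference_eq_partialShotNoise] at hω
  exact tendsto_nhds_limUnder hω

theorem charFun_map_aggregateInterference (hlam : 0 ≤ lam) (hP : 0 ≤ P) (hη : 2 < η)
    (hr₀ : 0 < r₀) (hx : IsPoissonPointProcess μ (exteriorIntensity lam r₀) x)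
    (hW : IsIndependentMarking μ (fadedSymbolLaw c) x fun k ω => s k ω * h k ω) (w : ℂ) :
    charFun (μ.map (aggregateInterference P η x s h)) w =
      (Real.exp (2 * Real.pi * lam * r₀ ^ 2 * normalizedExponent P η r₀ c ‖w‖) : ℝ) := by
  have : IsProbabilityMeasure (fadedSymbolLaw c) :=
    (hW.hasLaw 0).isProbabilityMeasure_iff.1 inferInstance
  have hlim := ae_tendsto_aggregateInterference hP hη hr₀ hx hW
  simp only [partialInterference_eq_partialShotNoise] at hlim
  rw [hW.charFun_map_of_tendsto_partialShotNoise hx (measurable_pathGain P η)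
    (integrable_pathGain_sq hP hη hr₀) (memLp_id_fadedSymbolLaw c) (integral_id_fadedSymbolLaw c)
    hlim, integral_one_sub_charFun_fadedSymbolLaw
      (ne_zero_of_isProbabilityMeasure_fadedSymbolLaw c) hlam hP hη hr₀,
    ← Complex.ofReal_neg, neg_neg, Complex.ofReal_exp]

theorem map_const_mul_aggregateInterference (hlam : 0 ≤ lam) (hP : 0 ≤ P) (hη : 2 < η)
    (hr₀ : 0 < r₀) (hx : IsPoissonPointProcess μ (exteriorIntensity lam r₀) x)
    (hW : IsIndependentMarking μ (fadedSymbolLaw c) x fun k ω => s k ω * h k ω)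
    {u : ℂ} (hu : ‖u‖ = 1) :
    μ.map (fun ω => u * aggregateInterference P η x s h ω) =
      μ.map (aggregateInterference P η x s h) :=
  map_const_mul_eq_of_charFun_radial
    (aemeasurable_aggregateInterference hx.measurable hW
      (ae_tendsto_aggregateInterference hP hη hr₀ hx hW))
    (f := fun r => (Real.exp (2 * Real.pi * lam * r₀ ^ 2 * normalizedExponent P η r₀ c r) : ℝ))
    (charFun_map_aggregateInterference hlam hP hη hr₀ hx hW) hu

theorem charFun_map_inner_aggregateInterference (hlam : 0 ≤ lam) (hP : 0 ≤ P) (hη : 2 < η)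
    (hr₀ : 0 < r₀) (hx : IsPoissonPointProcess μ (exteriorIntensity lam r₀) x)
    (hW : IsIndependentMarking μ (fadedSymbolLaw c) x fun k ω => s k ω * h k ω)
    {v : ℂ} (hv : ‖v‖ = 1) (t : ℝ) :
    charFun (μ.map fun ω => inner ℝ v (aggregateInterference P η x s h ω)) t =
      (Real.exp (2 * Real.pi * lam * r₀ ^ 2 * normalizedExponent P η r₀ c t) : ℝ) := by
  have hlim := ae_tendsto_aggregateInterference hP hη hr₀ hx hW
  rw [charFun_map_inner (aemeasurable_aggregateInterference hx.measurable hW hlim),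
    charFun_map_aggregateInterference hlam hP hη hr₀ hx hW, norm_smul, hv, mul_one,
    Real.norm_eq_abs, normalizedExponent_abs]

theorem cumulants_inner_aggregateInterference (hlam : 0 ≤ lam) (hP : 0 ≤ P) (hη : 2 < η)
    (hr₀ : 0 < r₀) (hx : IsPoissonPointProcess μ (exteriorIntensity lam r₀) x)
    (hW : IsIndependentMarking μ (fadedSymbolLaw c) x fun k ω => s k ω * h k ω)
    {v : ℂ} (hv : ‖v‖ = 1) :
    let X := fun ω => inner ℝ v (aggregateInterference P η x s h ω)
    (∀ r, ContDiffAt ℝ r (logCharFun μ X) 0) ∧ ∀ n : ℕ, 1 ≤ n →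
      (Odd n → cumulant μ X n = 0) ∧
      (Even n → cumulant μ X n =
        (Real.pi * lam * P ^ (n / 2) * n.descFactorial (n / 2) /
          (2 ^ (n - 1) * (η * n / 2 - 2)) * r₀ ^ (2 - η * n / 2) * symbolMoment c n : ℝ)) := by
  intro X
  have hX := charFun_map_inner_aggregateInterference hlam hP hη hr₀ hx hW hv
  have hsum := hasSum_pow_mul_exponentCoeff (lam := lam) (P := P) (r₀ := r₀) (c := c) hη
  refine ⟨contDiffAt_logCharFun hX hsum, fun n hn => ⟨cumulant_of_odd hX hsum, fun heven => ?_⟩⟩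
  obtain ⟨k, rfl⟩ := heven.two_dvd
  lift k to ℕ+ using by lia
  rw [cumulant_two_mul hX hsum, factorial_two_mul_mul_exponentCoeff hr₀,
    Nat.mul_div_cancel_left _ two_pos]

theorem integrable_and_integral_norm_sq_aggregateInterference (hlam : 0 ≤ lam) (hP : 0 ≤ P)
    (hη : 2 < η) (hr₀ : 0 < r₀) (hx : IsPoissonPointProcess μ (exteriorIntensity lam r₀) x)
    (hW : IsIndependentMarking μ (fadedSymbolLaw c) x fun k ω => s k ω * h k ω) :
    Integrable (fun ω => ‖aggregateInterference P η x s h ω‖ ^ 2) μ ∧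
      ∫ ω, ‖aggregateInterference P η x s h ω‖ ^ 2 ∂μ =
        2 * Real.pi * lam * P * r₀ ^ (2 - η) / (η - 2) * symbolMoment c 2 := by
  have hlim := ae_tendsto_aggregateInterference hP hη hr₀ hx hW
  simp only [partialInterference_eq_partialShotNoise] at hlim
  obtain ⟨hLp, hpower⟩ := hW.memLp_two_and_integral_norm_sq_of_tendsto_partialShotNoise hx
    (measurable_pathGain P η) (integrable_pathGain_sq hP hη hr₀) (memLp_id_fadedSymbolLaw c)
    (integral_id_fadedSymbolLaw c) hlim
  rw [integral_pathGain_sq hlam hP hη hr₀, integral_norm_sq_fadedSymbolLaw] at hpower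
  exact ⟨(memLp_two_iff_integrable_sq_norm hLp.1).1 hLp, hpower⟩

end AggregateInterference

theorem mainTheorem5_general {Ω : Type*} [MeasurableSpace Ω] (μ : Measure Ω)
    [IsProbabilityMeasure μ] (lam P η r₀ : ℝ) (hlam : 0 ≤ lam) (hP : 0 ≤ P) (hη : 2 < η)
    (hr₀ : 0 < r₀) (M : ℕ) (c : Fin M → ℂ) (x : ℕ → Ω → Plane) (s h : ℕ → Ω → ℂ)
    (hx : IsPoissonPointProcess μ (exteriorIntensity lam r₀) x)
    (hs : ∀ k, HasLaw (s k) (symbolLaw c) μ)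
    (hh : ∀ k, HasLaw (h k) stdComplexGaussian μ)
    (hmarks : iIndepFun (Sum.elim s h) μ)
    (hindep : IndepFun (fun ω (k : ℕ) => x k ω) (fun ω (j : ℕ ⊕ ℕ) => Sum.elim s h j ω) μ) :
    (∀ᵐ ω ∂μ, Tendsto (fun N => partialInterference P η x s h N ω) atTop
      (𝓝 (aggregateInterference P η x s h ω))) ∧
    AEMeasurable (aggregateInterference P η x s h) μ ∧
    (∀ u : ℂ, ‖u‖ = 1 →
      μ.map (fun ω => u * aggregateInterference P η x s h ω) =
        μ.map (aggregateInterference P η x s h)) ∧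
    (∀ w : ℂ, charFun (μ.map (aggregateInterference P η x s h)) w =
      ((Real.exp (Real.pi * lam / M * ∑ m : Fin M, r₀ ^ 2 *
        (1 - kummer (-(2 / η)) (1 - 2 / η)
          (-(‖w‖ ^ 2 * P * ‖c m‖ ^ 2 / (4 * r₀ ^ η))))) : ℝ) : ℂ)) ∧
    (∀ w : ℂ,
      Summable (fun k : ℕ+ => (-1 : ℝ) ^ (k : ℕ) * ‖w‖ ^ (2 * (k : ℕ)) *
        symbolMoment c (2 * (k : ℕ)) / ((η * ((k : ℕ) : ℝ) - 2) * ((k : ℕ)! : ℝ)) *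
          (P / (4 * r₀ ^ η)) ^ (k : ℕ)) ∧
      charFun (μ.map (aggregateInterference P η x s h)) w =
        ((Real.exp (2 * Real.pi * lam * r₀ ^ 2 *
          ∑' k : ℕ+, (-1 : ℝ) ^ (k : ℕ) * ‖w‖ ^ (2 * (k : ℕ)) *
            symbolMoment c (2 * (k : ℕ)) / ((η * ((k : ℕ) : ℝ) - 2) * ((k : ℕ)! : ℝ)) *
              (P / (4 * r₀ ^ η)) ^ (k : ℕ)) : ℝ) : ℂ)) ∧
    (∀ X : Ω → ℝ,
      (X = (fun ω => (aggregateInterference P η x s h ω).re) ∨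
        X = (fun ω => (aggregateInterference P η x s h ω).im)) →
      ContDiffAt ℝ ((⊤ : ℕ∞) : WithTop ℕ∞) (logCharFun μ X) 0 ∧
      ∀ n : ℕ, 1 ≤ n →
        (Odd n → cumulant μ X n = 0) ∧
        (Even n → cumulant μ X n =
          ((Real.pi * lam * P ^ (n / 2) * (n.descFactorial (n / 2) : ℝ) /
            (2 ^ (n - 1) * (η * (n : ℝ) / 2 - 2)) * r₀ ^ (2 - η * (n : ℝ) / 2) *
              symbolMoment c n : ℝ) : ℂ))) ∧
    Integrable (fun ω => ‖aggregateInterference P η x s h ω‖ ^ 2) μ ∧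
    ∫ ω, ‖aggregateInterference P η x s h ω‖ ^ 2 ∂μ =
      2 * Real.pi * lam * P * r₀ ^ (2 - η) / (η - 2) * symbolMoment c 2 := by
  have hW := isIndependentMarking_mul hs hh hmarks hindep
  have hlim := ae_tendsto_aggregateInterference hP hη hr₀ hx hW
  have hcharFun := charFun_map_aggregateInterference hlam hP hη hr₀ hx hW
  have hcumulants {v : ℂ} (hv : ‖v‖ = 1) :=
    cumulants_inner_aggregateInterference hlam hP hη hr₀ hx hW hv
  refine ⟨hlim, aemeasurable_aggregateInterference hx.measurable hW hlim,
    fun u => map_const_mul_aggregateInterference hlam hP hη hr₀ hx hW,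
    fun w => ?_, fun w => ⟨(hasSum_normalizedExponent hη ‖w‖).summable, ?_⟩, ?_,
    integrable_and_integral_norm_sq_aggregateInterference hlam hP hη hr₀ hx hW⟩
  · rw [hcharFun, mul_normalizedExponent_eq]
  · rw [hcharFun, (hasSum_normalizedExponent hη ‖w‖).tsum_eq]
  · rintro X (rfl | rfl)
    · simpa [Complex.inner] using (hcumulants norm_one).imp_left fun hsmooth => hsmooth (⊤ : ℕ∞)
    · simpa [Complex.inner] using (hcumulants Complex.norm_I).imp_left fun hsmooth =>
        hsmooth (⊤ : ℕ∞)

theorem mainTheorem5 {Ω : Type*} [MeasurableSpace Ω] (μ : Measure Ω) [IsProbabilityMeasure μ]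
    (lam P η r₀ : ℝ) (hlam : 0 < lam) (hP : 0 < P) (hη : 2 < η) (hr₀ : 0 < r₀)
    (M : ℕ) (c : Fin M → ℂ) (hc : symbolMoment c 2 = 1)
    (x : ℕ → Ω → Plane) (s h : ℕ → Ω → ℂ)
    -- the interferers form a Poisson process outside the disc, enumerated by distance
    (hx : IsPoissonPointProcess μ (exteriorIntensity lam r₀) x)
    (hmono : ∀ᵐ ω ∂μ, Monotone (fun k => ‖x k ω‖))
    -- equiprobable symbols and Rayleigh fading, all independent, and independent of the locations
    (hs : ∀ k, HasLaw (s k) (symbolLaw c) μ)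
    (hh : ∀ k, HasLaw (h k) stdComplexGaussian μ)
    (hmarks : iIndepFun (Sum.elim s h) μ)
    (hindep : IndepFun (fun ω (k : ℕ) => x k ω) (fun ω (j : ℕ ⊕ ℕ) => Sum.elim s h j ω) μ) :
    -- the aggregate interference is a well-defined random variable
    (∀ᵐ ω ∂μ, Tendsto (fun N => partialInterference P η x s h N ω) atTop
      (𝓝 (aggregateInterference P η x s h ω))) ∧
    AEMeasurable (aggregateInterference P η x s h) μ ∧
    -- circular symmetry
    (∀ u : ℂ, ‖u‖ = 1 →
      μ.map (fun ω => u * aggregateInterference P η x s h ω) =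
        μ.map (aggregateInterference P η x s h)) ∧
    -- characteristic function, hypergeometric form
    (∀ w : ℂ, charFun (μ.map (aggregateInterference P η x s h)) w =
      ((Real.exp (Real.pi * lam / M * ∑ m : Fin M, r₀ ^ 2 *
        (1 - kummer (-(2 / η)) (1 - 2 / η)
          (-(‖w‖ ^ 2 * P * ‖c m‖ ^ 2 / (4 * r₀ ^ η))))) : ℝ) : ℂ)) ∧
    -- characteristic function, power series form
    (∀ w : ℂ,
      Summable (fun k : ℕ+ => (-1 : ℝ) ^ (k : ℕ) * ‖w‖ ^ (2 * (k : ℕ)) *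
        symbolMoment c (2 * (k : ℕ)) / ((η * ((k : ℕ) : ℝ) - 2) * ((k : ℕ)! : ℝ)) *
          (P / (4 * r₀ ^ η)) ^ (k : ℕ)) ∧
      charFun (μ.map (aggregateInterference P η x s h)) w =
        ((Real.exp (2 * Real.pi * lam * r₀ ^ 2 *
          ∑' k : ℕ+, (-1 : ℝ) ^ (k : ℕ) * ‖w‖ ^ (2 * (k : ℕ)) *
            symbolMoment c (2 * (k : ℕ)) / ((η * ((k : ℕ) : ℝ) - 2) * ((k : ℕ)! : ℝ)) *
              (P / (4 * r₀ ^ η)) ^ (k : ℕ)) : ℝ) : ℂ)) ∧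
    -- the cumulants per dimension exist and are explicit
    (∀ X : Ω → ℝ,
      (X = (fun ω => (aggregateInterference P η x s h ω).re) ∨
        X = (fun ω => (aggregateInterference P η x s h ω).im)) →
      ContDiffAt ℝ ((⊤ : ℕ∞) : WithTop ℕ∞) (logCharFun μ X) 0 ∧
      ∀ n : ℕ, 1 ≤ n →
        (Odd n → cumulant μ X n = 0) ∧
        (Even n → cumulant μ X n =
          ((Real.pi * lam * P ^ (n / 2) * (n.descFactorial (n / 2) : ℝ) /
            (2 ^ (n - 1) * (η * (n : ℝ) / 2 - 2)) * r₀ ^ (2 - η * (n : ℝ) / 2) *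
              symbolMoment c n : ℝ) : ℂ))) ∧
    -- the expected interference power
    Integrable (fun ω => ‖aggregateInterference P η x s h ω‖ ^ 2) μ ∧
    ∫ ω, ‖aggregateInterference P η x s h ω‖ ^ 2 ∂μ =
      2 * Real.pi * lam * P * r₀ ^ (2 - η) / (η - 2) := by
  simpa only [hc, mul_one] using
    mainTheorem5_general μ lam P η r₀ hlam.le hP.le hη hr₀ M c x s h hx hs hh hmarks hindep
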